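/- \textbf{Conventions.} A map $f:X\to Y$ of metric spaces is a $C$-rough isometry if $d(x,y)-C\le d(fx,fy)\le d(x,y)+C$ for all $x,y$. It is a quasi-isometry if for some $L\ge 1$, $C\ge 0$ one has $L^{-1}d(x,y)-C\le d(fx,fy)\le L\,d(x,y)+C$ for all $x,y$ and $Y$ is the $L$-neighborhood of $f(X)$. A space $X$ is roughly geodesic if for some $C>0$ any two of its points are joined by a $C$-rough isometry from a compact interval. It is Gromov hyperbolic if it is roughly geodesic and, for some $\delta\ge 0$, $(x|x'')_y\ge\min\{(x|x')_y,(x'|x'')_y\}-\delta$ for all $x,x',x'',y$, where $(x|x')_y=\frac12(d(x,y)+d(y,x')-d(x,x'))$. A roughly geodesic ray is a map $[0,\infty)\to X$ that is a $C$-rough isometry for some $C>0$, and $\partial_\infty X$ is the set of these rays modulo bounded Hausdorff distance of their images. An arbitrary map $[0,\infty)\to X$ represents a point of $\partial_\infty X$ if its image is at bounded Hausdorff distance from the rays in that class. A metric $d$ on $\partial_\infty X\setminus\{\omega\}$ is a parabolic visual metric if there is $a>1$ such that for every roughly geodesic ray $\eta$ in the class $\omega$ there is $L\ge1$ such that, for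 all roughly geodesic rays $\xi,\zeta$ not in the class $\omega$, $$L^{-1}d([\xi],[\zeta])\le\liminf_{t\to\infty}a^{\,t-(\xi(t)|\zeta(t))_{\eta(t)}}\le\limsup_{t\to\infty}a^{\,t-(\xi(t)|\zeta(t))_{\eta(t)}}\le L\,d([\xi],[\zeta]).$$ A metric $d$ on $\partial_\infty X\setminus\{\omega\}$ is in the parabolic conformal gauge if there are a parabolic visual metric $d'$ on $\partial_\infty X\setminus\{\omega\}$ and an increasing bijection $\eta$ of $[0,\infty)$ with $\frac{d'(x,y)}{d'(x,z)}\le\eta\left(\frac{d(x,y)}{d(x,z)}\right)$ for all $x,y,z$ with $x\ne z$. \textbf{Metric similarity spaces.} Let $(H,d_H)$ be a complete metric space homeomorphic to $\mathbb R^n$ with a stacked tiling: a discrete group $\Gamma$ of isometries of $H$ acting properly; a compact connected set $K\subset H$ with non-empty interior such that $H=\bigcup_{\gamma\in\Gamma}\gamma K$ and the interiors of $K$ and $\gamma K$ are disjoint for $1\ne\gamma\in\Gamma$; and a bijection $\alpha:H\to H$ multiplying all distances by some $a>1$, such that $\alpha\Gamma\alpha^{-1}\subset\Gamma$ and $\alpha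 K$ is a union of finitely many sets $\gamma K$, $\gamma\in\Gamma$. Let $H^+=H\times(0,\infty)$ carry a smooth structure compatible with the product topology and a Riemannian metric whose distance $d_{H^+}$ is invariant under $(x,t)\mapsto(\gamma x,t)$ for every $\gamma\in\Gamma$ and under $(x,t)\mapsto(\alpha x,at)$. Let $\mathrm{Con}(H)$ be $H\times(0,\infty)$ with the metric $$d\big((x,t),(x',t')\big)=2\log\frac{d_H(x,x')+\max\{t,t'\}}{\sqrt{tt'}}.$$ \textbf{Theorem.} \begin{enumerate} \item The identity map $H^+\to\mathrm{Con}(H)$ is a quasi-isometry. \item $H^+$ is Gromov hyperbolic. \item There is a (unique) map $\iota:H\cup\{\infty\}\to\partial_\infty H^+$ such that, for every $x\in H$, the ray $s\mapsto(x,e^{-s})$ represents $\iota(x)$ and the ray $s\mapsto(x,e^{s})$ represents $\iota(\infty)$. The map $\iota$ is a bijection. \item The metric $d_H$, transported by the bijection $\iota|_H:H\to\partial_\infty H^+\setminus\{\iota(\infty)\}$, is in the parabolic conformal gauge of $\partial_\infty H^+\setminus\{\iota(\infty)\}$. \end{enumerate} -/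

import Mathlib

open Set Filter Topology Manifold Bundle
open scoped ContDiff NNReal

noncomputable section

/-! ### Rough isometries, quasi-isometries, Gromov hyperbolicity -/

/-- `f` distorts distances by at most the additive constant `C`. It need not be continuous or
surjective. -/
def IsRoughIsometry {X Y : Type*} [MetricSpace X] [MetricSpace Y] (C : ℝ) (f : X → Y) : Prop :=
  ∀ x y, -C + dist x y ≤ dist (f x) (f y) ∧ dist (f x) (f y) ≤ dist x y + C

/-- `X` is `C`-roughly geodesic for some `C > 0`: any two points are joined by a `C`-rough
isometry defined on a compact interval. -/
def IsRoughlyGeodesic (X : Type*) [MetricSpace X] : Prop :=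
  ∃ C : ℝ, 0 < C ∧ ∀ x y : X, ∃ (l : ℝ) (hl : 0 ≤ l) (f : Icc (0 : ℝ) l → X),
    IsRoughIsometry C f ∧ f ⟨0, le_refl 0, hl⟩ = x ∧ f ⟨l, hl, le_refl l⟩ = y

/-- The Gromov product `(x | y)` with base point `p`. -/
def gromovProd {X : Type*} [MetricSpace X] (x y p : X) : ℝ :=
  (dist x p + dist p y - dist x y) / 2

/-- Gromov hyperbolicity: roughly geodesic, and the four-point inequality holds for some `δ`. -/
def IsGromovHyperbolic (X : Type*) [MetricSpace X] : Prop :=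
  IsRoughlyGeodesic X ∧ ∃ δ : ℝ, 0 ≤ δ ∧ ∀ x x' x'' y : X,
    min (gromovProd x x' y) (gromovProd x' x'' y) - δ ≤ gromovProd x x'' y

/-- `f` is an `(L, C)`-quasi-isometry from `X` to `Y` for some `L ≥ 1` and `C ≥ 0`; in particular
`Y` is the `L`-neighborhood of the image. -/
def IsQuasiIsometry {X Y : Type*} [MetricSpace X] [MetricSpace Y] (f : X → Y) : Prop :=
  ∃ L C : ℝ, 1 ≤ L ∧ 0 ≤ C ∧
    (∀ x y, -C + L⁻¹ * dist x y ≤ dist (f x) (f y) ∧ dist (f x) (f y) ≤ L * dist x y + C) ∧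
    ∀ y, ∃ x, dist (f x) y < L

/-- `g` is surjective and `η`-quasi-symmetric for some increasing bijection `η` of `[0, ∞)`. -/
def IsQuasiSymmetry {X Y : Type*} [MetricSpace X] [MetricSpace Y] (g : X → Y) : Prop :=
  Function.Surjective g ∧ ∃ η : ℝ≥0 ≃o ℝ≥0, ∀ x y z, x ≠ z →
    nndist (g x) (g y) / nndist (g x) (g z) ≤ η (nndist x y / nndist x z)

/-! ### The boundary at infinity -/

/-- Roughly geodesic rays: maps from `[0, ∞)` that are `C`-rough isometries for some `C > 0`. -/
structure RoughRay (X : Type*) [MetricSpace X] where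
  toFun : ℝ≥0 → X
  rough : ∃ C : ℝ, 0 < C ∧ IsRoughIsometry C toFun

/-- Two maps into `X` whose images are at bounded Hausdorff distance. -/
def FiniteHausdorff {X S T : Type*} [MetricSpace X] (f : S → X) (g : T → X) : Prop :=
  Metric.hausdorffEDist (range f) (range g) ≠ ⊤

/-- Roughly geodesic rays are equivalent if they are at bounded Hausdorff distance. -/
instance RoughRay.setoid (X : Type*) [MetricSpace X] : Setoid (RoughRay X) where
  r ξ ζ := FiniteHausdorff ξ.toFun ζ.toFun
  iseqv :=
    { refl := fun ξ => by simp [FiniteHausdorff, Metric.hausdorffEDist_self]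
      symm := fun {ξ ζ} h => by
        unfold FiniteHausdorff at *
        rwa [Metric.hausdorffEDist_comm]
      trans := fun {ξ ζ χ} h h' => ne_top_of_le_ne_top (ENNReal.add_ne_top.2 ⟨h, h'⟩)
        Metric.hausdorffEDist_triangle }

/-- The boundary at infinity of `X`. -/
def BoundaryAtInfinity (X : Type*) [MetricSpace X] : Type _ :=
  Quotient (RoughRay.setoid X)

/-- The class of a roughly geodesic ray. -/
def RoughRay.endpoint {X : Type*} [MetricSpace X] (ξ : RoughRay X) : BoundaryAtInfinity X :=
  Quotient.mk (RoughRay.setoid X) ξ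

/-- The (quasi-geodesic) ray `f` represents the boundary point `b`: it is at bounded Hausdorff
distance from the roughly geodesic rays in the class `b`. At most one `b` has this property. -/
def Represents {X : Type*} [MetricSpace X] (f : ℝ≥0 → X) (b : BoundaryAtInfinity X) : Prop :=
  ∀ ξ : RoughRay X, ξ.endpoint = b → FiniteHausdorff ξ.toFun f

/-! ### Parabolic visual metrics and the parabolic conformal gauge -/

/-- The boundary without the point `ϖ`. -/
abbrev PuncturedBoundary {X : Type*} [MetricSpace X] (ϖ : BoundaryAtInfinity X) : Type _ :=
  {b : BoundaryAtInfinity X // b ≠ ϖ}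

/-- `a ^ (t - (ξ(t) | ζ(t))_{η(t)})`, whose limiting values as `t → ∞` form the parabolic visual
quasimetric based at the ray `η`. -/
def parabolicVisual {X : Type*} [MetricSpace X] (a : ℝ) (η ξ ζ : RoughRay X) (t : ℝ≥0) : ℝ :=
  a ^ ((t : ℝ) - gromovProd (ξ.toFun t) (ζ.toFun t) (η.toFun t))

/-- The metric `m` on the boundary punctured at `ϖ` is a parabolic visual metric: for some `a > 1`,
it is bi-Lipschitz to the `(ϖ, a)`-parabolic visual quasimetric. For roughly geodesic rays the
limit defining the quasimetric need not exist and depends on the representatives (both only up to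
bounded factors), so the bounds are required of all limiting values (`liminf` and `limsup`) and of
all representatives `ξ`, `ζ`, with a constant that does not depend on them. -/
def IsParabolicVisualMetric {X : Type*} [MetricSpace X] (ϖ : BoundaryAtInfinity X)
    (m : MetricSpace (PuncturedBoundary ϖ)) : Prop :=
  ∃ a : ℝ, 1 < a ∧ ∀ η : RoughRay X, η.endpoint = ϖ → ∃ L : ℝ, 1 ≤ L ∧
    ∀ (ξ ζ : RoughRay X) (hξ : ξ.endpoint ≠ ϖ) (hζ : ζ.endpoint ≠ ϖ),
      ENNReal.ofReal (L⁻¹ * m.dist ⟨ξ.endpoint, hξ⟩ ⟨ζ.endpoint, hζ⟩) ≤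
          liminf (fun t => ENNReal.ofReal (parabolicVisual a η ξ ζ t)) atTop ∧
        limsup (fun t => ENNReal.ofReal (parabolicVisual a η ξ ζ t)) atTop ≤
          ENNReal.ofReal (L * m.dist ⟨ξ.endpoint, hξ⟩ ⟨ζ.endpoint, hζ⟩)

/-- The metric `m` is in the conformal gauge of the boundary punctured at `ϖ`: the identity map
from `m` to some parabolic visual metric is a quasi-symmetry. -/
def InParabolicConformalGauge {X : Type*} [MetricSpace X] (ϖ : BoundaryAtInfinity X)
    (m : MetricSpace (PuncturedBoundary ϖ)) : Prop :=
  ∃ m' : MetricSpace (PuncturedBoundary ϖ), IsParabolicVisualMetric ϖ m' ∧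
    @IsQuasiSymmetry _ _ m m' (id : PuncturedBoundary ϖ → PuncturedBoundary ϖ)

/-! ### The half-space over `H` and the hyperbolic cone -/

/-- The set `H × (0, ∞)`. It carries no metric or topology of its own. -/
@[ext] structure HPlus (H : Type*) where
  base : H
  height : ℝ
  height_pos : 0 < height

namespace HPlus

/-- The tautological map to the product `H × (0, ∞)`. -/
def toProd {H : Type*} (p : HPlus H) : H × Ioi (0 : ℝ) := (p.base, ⟨p.height, p.height_pos⟩)

/-- The map `(x, t) ↦ (f x, c t)`. -/
def map {H : Type*} (f : H → H) (c : ℝ) (hc : 0 < c) (p : HPlus H) : HPlus H :=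
  ⟨f p.base, c * p.height, mul_pos hc p.height_pos⟩

/-- The ray `γ_x(s) = (x, e^{-s})`. -/
def downRay {H : Type*} (x : H) (s : ℝ≥0) : HPlus H := ⟨x, Real.exp (-s), Real.exp_pos _⟩

/-- The ray `γ_{∞,x}(s) = (x, e^s)`. -/
def upRay {H : Type*} (x : H) (s : ℝ≥0) : HPlus H := ⟨x, Real.exp s, Real.exp_pos _⟩

end HPlus

/-- The hyperbolic cone `Con(X)`, for `X` of infinite diameter: the set `X × (0, ∞)` with the metric
`d((x,t),(x',t')) = 2 log ((d(x,x') + max(t,t')) / √(t t'))`. -/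
def HypCone (X : Type*) : Type _ := HPlus X

/-- The identity map of the underlying sets. -/
def HPlus.toCone {X : Type*} (p : HPlus X) : HypCone X := p

namespace HypCone

/-- The distance of the hyperbolic cone. -/
def coneDist {X : Type*} [MetricSpace X] (p q : HPlus X) : ℝ :=
  2 * Real.log ((dist p.base q.base + max p.height q.height) / √(p.height * q.height))

theorem coneDist_triangle {X : Type*} [MetricSpace X] (p q r : HPlus X) :
    coneDist p r ≤ coneDist p q + coneDist q r := by
  obtain ⟨x, s, hs⟩ := p
  obtain ⟨y, t, ht⟩ := q
  obtain ⟨z, u, hu⟩ := r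
  have num_pos : ∀ (a b : X) (c d : ℝ), 0 < c → 0 < dist a b + max c d := fun a b c d hc =>
    add_pos_of_nonneg_of_pos dist_nonneg (lt_max_of_lt_left hc)
  have hst : 0 < √(s * t) := Real.sqrt_pos.2 (mul_pos hs ht)
  have htu : 0 < √(t * u) := Real.sqrt_pos.2 (mul_pos ht hu)
  have hsu : 0 < √(s * u) := Real.sqrt_pos.2 (mul_pos hs hu)
  have h1 := num_pos x y s t hs
  have h2 := num_pos y z t u ht
  have h3 := num_pos x z s u hs
  unfold coneDist
  simp only
  rw [← mul_add, ← Real.log_mul (div_pos h1 hst).ne' (div_pos h2 htu).ne']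
  refine mul_le_mul_of_nonneg_left (Real.log_le_log (div_pos h3 hsu) ?_) zero_le_two
  rw [div_mul_div_comm]
  have hden : √(s * t) * √(t * u) = t * √(s * u) := by
    rw [← Real.sqrt_mul (mul_pos hs ht).le,
      show s * t * (t * u) = t ^ 2 * (s * u) by ring, Real.sqrt_mul (sq_nonneg t),
      Real.sqrt_sq ht.le]
  rw [hden, div_le_div_iff₀ hsu (mul_pos ht hsu)]
  have key : (dist x z + max s u) * t ≤ (dist x y + max s t) * (dist y z + max t u) := by
    have hmax : max s u * t ≤ max s t * max t u := by
      rcases max_cases s u with ⟨h, _⟩ | ⟨h, _⟩ <;> rw [h]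
      · exact mul_le_mul (le_max_left _ _) (le_max_left _ _) ht.le
          (hs.le.trans (le_max_left _ _))
      · rw [mul_comm]
        exact mul_le_mul (le_max_right _ _) (le_max_right _ _) hu.le
          (hs.le.trans (le_max_left _ _))
    have e1 : dist x y * t ≤ dist x y * max t u :=
      mul_le_mul_of_nonneg_left (le_max_left _ _) dist_nonneg
    have e2 : t * dist y z ≤ max s t * dist y z :=
      mul_le_mul_of_nonneg_right (le_max_right _ _) dist_nonneg
    have e3 : 0 ≤ dist x y * dist y z := mul_nonneg dist_nonneg dist_nonneg
    have e4 : dist x z * t ≤ (dist x y + dist y z) * t :=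
      mul_le_mul_of_nonneg_right (dist_triangle _ _ _) ht.le
    nlinarith
  nlinarith [mul_le_mul_of_nonneg_right key hsu.le]

theorem coneDist_self {X : Type*} [MetricSpace X] (p : HPlus X) : coneDist p p = 0 := by
  have h := p.height_pos
  simp [coneDist, Real.sqrt_mul_self h.le, div_self h.ne']

theorem coneDist_comm {X : Type*} [MetricSpace X] (p q : HPlus X) :
    coneDist p q = coneDist q p := by
  simp [coneDist, dist_comm, max_comm, mul_comm]

theorem eq_of_coneDist_eq_zero {X : Type*} [MetricSpace X] {p q : HPlus X}
    (h : coneDist p q = 0) : p = q := by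
  obtain ⟨x, s, hs⟩ := p
  obtain ⟨y, t, ht⟩ := q
  have hst : 0 < √(s * t) := Real.sqrt_pos.2 (mul_pos hs ht)
  have hnum : 0 < dist x y + max s t :=
    add_pos_of_nonneg_of_pos dist_nonneg (lt_max_of_lt_left hs)
  have h1 : (dist x y + max s t) / √(s * t) = 1 := by
    refine Real.eq_one_of_pos_of_log_eq_zero (div_pos hnum hst) ?_
    simpa [coneDist] using h
  rw [div_eq_one_iff_eq hst.ne'] at h1
  have hsq : (dist x y + max s t) ^ 2 = s * t := by
    rw [h1, Real.sq_sqrt (mul_pos hs ht).le]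
  have hd : 0 ≤ dist x y := dist_nonneg
  have hs' : s ≤ max s t := le_max_left _ _
  have ht' : t ≤ max s t := le_max_right _ _
  have hmm : s * t ≤ max s t * max s t := mul_le_mul hs' ht' ht.le (hs.le.trans hs')
  have hd0 : dist x y = 0 := by nlinarith
  have hmax : max s t * max s t = s * t := by rw [hd0] at hsq; nlinarith
  have hse : s = max s t := by nlinarith
  have hte : t = max s t := by nlinarith
  have hxy : x = y := dist_eq_zero.1 hd0
  subst hxy
  have hst' : s = t := hse.trans hte.symm
  subst hst'
  rfl

instance instMetricSpace (X : Type*) [MetricSpace X] : MetricSpace (HypCone X) where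
  dist p q := coneDist p q
  dist_self p := coneDist_self p
  dist_comm p q := coneDist_comm p q
  dist_triangle p q r := coneDist_triangle p q r
  eq_of_dist_eq_zero h := eq_of_coneDist_eq_zero h

end HypCone

/-! ### Stacked tilings and metric similarity spaces -/

/-- A stacked tiling of the complete metric space `H`, homeomorphic to `ℝⁿ`. -/
structure StackedTiling (n : ℕ) (H : Type*) [MetricSpace H] where
  complete : CompleteSpace H
  homeo : Nonempty (H ≃ₜ EuclideanSpace ℝ (Fin n))
  /-- The group of isometries. -/
  Γ : Subgroup (H ≃ᵢ H)
  /-- `Γ` is discrete and acts properly. -/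
  proper : ∀ C : Set H, IsCompact C → {γ : H ≃ᵢ H | γ ∈ Γ ∧ (γ '' C ∩ C).Nonempty}.Finite
  /-- The compact connected domain whose translates tile `H`. -/
  K : Set H
  K_compact : IsCompact K
  K_connected : IsConnected K
  K_interior : (interior K).Nonempty
  cover : ⋃ γ ∈ Γ, γ '' K = univ
  disjoint_interiors : ∀ γ ∈ Γ, γ ≠ 1 → Disjoint (interior K) (interior (γ '' K))
  /-- The scaling factor. -/
  a : ℝ
  one_lt_a : 1 < a
  /-- The homothety. -/
  α : H ≃ H
  dist_α : ∀ x y, dist (α x) (α y) = a * dist x y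
  conj_mem : ∀ γ ∈ Γ, ∃ γ' ∈ Γ, ∀ x, γ' x = α (γ (α.symm x))
  finite_subdivision : ∃ F : Set (H ≃ᵢ H), F.Finite ∧ F ⊆ Γ ∧ α '' K = ⋃ γ ∈ F, γ '' K

/-- The metric on `H⁺ = H × (0, ∞)` makes it a metric similarity space with base `H` with respect to
the stacked tiling `T`, provided it is Riemannian (which is expressed by Mathlib's type classes): it
induces the product topology, and `(x, t) ↦ (γ x, t)` and `(x, t) ↦ (α x, a t)` are isometries. -/
structure IsMetricSimilaritySpace {n : ℕ} {H : Type*} [MetricSpace H] [MetricSpace (HPlus H)]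
    (T : StackedTiling n H) : Prop where
  product_topology : IsHomeomorph (HPlus.toProd : HPlus H → H × Ioi (0 : ℝ))
  isometry_Γ : ∀ γ ∈ T.Γ, Isometry (HPlus.map (H := H) γ 1 one_pos)
  isometry_α : Isometry (HPlus.map (H := H) T.α T.a (one_pos.trans T.one_lt_a))

/-- `ι` is the map `H ∪ {∞} → ∂H⁺` that sends `x` to the class of `γ_x` and `∞` to the class of the
rays `γ_{∞,x}`. At most one map has this property. -/
def IsEndpointMap {H : Type*} [MetricSpace (HPlus H)]
    (ι : OnePoint H → BoundaryAtInfinity (HPlus H)) : Prop :=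
  (∀ x : H, Represents (HPlus.downRay x) (ι (x : OnePoint H))) ∧
    ∀ x : H, Represents (HPlus.upRay x) (ι OnePoint.infty)

end

/-! For points `p = (x, t)` and `q = (x', t')` put `num p q = d_H(x, x') + max t t'`. The cone
distance is `2 log (num p q) - log t - log t'`, so the exponential of a Gromov product is a quotient
of values of `num`, and hyperbolicity of the cone is a Ptolemy inequality for `num` up to the factor
4 (`num_ptolemy`).

The group `Γ` and the homothety preserve both distances on `H × (0, ∞)` and move every point into
the compact core `K × [1, a]`. By compactness each distance is controlled by the other at a fixed
scale. The cone is roughly geodesic and `H⁺` is a length space, so chaining small steps makes the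
identity a quasi-isometry (`exists_isQuasiEmbedding`), as in the Milnor–Švarc lemma. By the Morse
lemma (`exists_gromovProd_le`) hyperbolicity passes to `H⁺`, and "`w` lies roughly between `p` and
`q`" means the same for both distances. In the cone this relation is the inequality `num p w * num w
q ≤ c * w.height * num p q`. This dictionary is `ConeComparison`; it shows that every rough ray of
`H⁺` is close to a vertical one, whence the bijection from `H ∪ {∞}` to the boundary.

For the last claim the multiplicative distortion of the quasi-isometry must be uniform. The Busemann
function of `∞` is quasi-equivariant under the symmetries. It has bounded values on the `Γ`-orbit of
the base point, because powers of an isometry displace only logarithmically, and it grows linearly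
along the axis of the homothety. Hence it is `κ log (height)` up to a bounded error
(`exists_busemann_height`). The exponents `t - (ξ(t)|ζ(t))_{η(t)}` are then `κ log d_H(x, y)` up to
a bounded error, and with parameter `e ^ (1/κ)` the metric `d_H` itself is parabolic visual. -/

noncomputable section

/-! ### The Morse lemma and the invariance of hyperbolicity. -/

section Coarse

variable {X Y : Type*} [MetricSpace X] [MetricSpace Y]

theorem gromovProd_le_add_dist (x z w v : X) :
    gromovProd x z w ≤ gromovProd x z v + dist w v := by
  unfold gromovProd
  linarith [dist_triangle x v w, dist_triangle w v z, dist_comm v w]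

/-- The four-point inequality in terms of distances. -/
theorem four_point_of_gromovProd {δ : ℝ}
    (h : ∀ x x' x'' y : Y,
      min (gromovProd x x' y) (gromovProd x' x'' y) - δ ≤ gromovProd x x'' y) (x z w p : Y) :
    dist w p + dist x z ≤ max (dist w x + dist p z) (dist w z + dist p x) + 2 * δ := by
  have := h x w z p
  unfold gromovProd at this
  rw [dist_comm w p, dist_comm w x]
  rw [dist_comm x p] at this
  rcases le_total ((dist p x + dist p w - dist x w) / 2) ((dist w p + dist p z - dist w z) / 2)
    with h1 | h1
  · rw [min_eq_left h1] at this
    linarith [le_max_left (dist x w + dist p z) (dist w z + dist p x)]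
  · rw [min_eq_right h1] at this
    linarith [le_max_right (dist x w + dist p z) (dist w z + dist p x), dist_comm p w]

/-- A point that is far from a coarse path sees its end points with a large Gromov product. -/
theorem le_gromovProd_of_path {δ A D : ℝ}
    (h4 : ∀ x x' x'' y : Y,
      min (gromovProd x x' y) (gromovProd x' x'' y) - δ ≤ gromovProd x x'' y)
    (q : ℝ → Y) (p : Y) (I : Set ℝ) (hI : I.OrdConnected)
    (hA : ∀ s ∈ I, ∀ u ∈ I, |s - u| ≤ 1 → dist (q s) (q u) ≤ A)
    (hD : ∀ s ∈ I, D ≤ dist p (q s)) (k : ℕ) :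
    ∀ s ∈ I, ∀ u ∈ I, |s - u| ≤ 2 ^ k → D - A / 2 - k * δ ≤ gromovProd (q s) (q u) p := by
  induction k with
  | zero =>
    intro s hs u hu hsu
    have := hA s hs u hu (by simpa using hsu)
    unfold gromovProd
    have h1 := hD s hs
    have h2 := hD u hu
    rw [dist_comm (q s) p]
    push_cast
    linarith
  | succ k ih =>
    intro s hs u hu hsu
    -- Each halving costs one `δ`, so a path of parameter length `2 ^ k` costs only `k * δ`.
    have hm : (s + u) / 2 ∈ I := by
      refine hI.uIcc_subset hs hu ?_
      rw [mem_uIcc]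
      rcases le_total s u with h | h
      · left; constructor <;> linarith
      · right; constructor <;> linarith
    rw [pow_succ] at hsu
    have e1 : |s - (s + u) / 2| ≤ 2 ^ k := by
      rw [show s - (s + u) / 2 = (s - u) / 2 by ring, abs_div, abs_of_pos (two_pos : (0:ℝ) < 2)]
      linarith
    have e2 : |(s + u) / 2 - u| ≤ 2 ^ k := by
      rw [show (s + u) / 2 - u = (s - u) / 2 by ring, abs_div, abs_of_pos (two_pos : (0:ℝ) < 2)]
      linarith
    have := h4 (q s) (q ((s + u) / 2)) (q u) p
    have := le_min (ih s hs _ hm e1) (ih _ hm u hu e2)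
    push_cast
    linarith

/-- A quantity bounded by the logarithm of a linear function of itself is bounded. -/
theorem exists_bound_of_le_log (α β b δ : ℝ) (hα : 0 ≤ α) (hδ : 0 ≤ δ) :
    ∃ D₀ : ℝ, ∀ D : ℝ, (∀ k : ℕ, α * D + β ≤ 2 ^ k → D ≤ b + k * δ) → D ≤ D₀ := by
  have hlim : Tendsto (fun k : ℕ => (α * (b + (k + 1) * δ) + β) / (2 : ℝ) ^ k) atTop (𝓝 0) := by
    have h1 : Tendsto (fun k : ℕ => (k : ℝ) ^ 1 / (2 : ℝ) ^ k) atTop (𝓝 0) :=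
      tendsto_pow_const_div_const_pow_of_one_lt 1 one_lt_two
    have h0 : Tendsto (fun k : ℕ => (k : ℝ) ^ 0 / (2 : ℝ) ^ k) atTop (𝓝 0) :=
      tendsto_pow_const_div_const_pow_of_one_lt 0 one_lt_two
    have := (h1.const_mul (α * δ)).add (h0.const_mul (α * b + α * δ + β))
    simp only [mul_zero, add_zero] at this
    refine this.congr fun k => ?_
    ring
  obtain ⟨K, hK⟩ := (eventually_atTop.1 (hlim.eventually (gt_mem_nhds zero_lt_one)))
  refine ⟨b + (K + 1 : ℕ) * δ, fun D hD => ?_⟩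
  have hex : ∃ k : ℕ, α * D + β ≤ 2 ^ k := by
    obtain ⟨k, hk⟩ := pow_unbounded_of_one_lt (α * D + β) (one_lt_two (α := ℝ))
    exact ⟨k, hk.le⟩
  classical
  -- Use the least admissible exponent. If it were `j + 1` with `j > K`, minimality would give `2 ^
  -- j < α * D + β`, against `D ≤ b + (j + 1) * δ` and the choice of `K`.
  have hk := Nat.find_spec hex
  have hDk := hD _ hk
  have hle : Nat.find hex ≤ K + 1 := by
    by_contra! hlt
    obtain ⟨j, hj⟩ : ∃ j, Nat.find hex = j + 1 := ⟨Nat.find hex - 1, by omega⟩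
    have hmin := Nat.find_min hex (m := j) (by omega)
    rw [hj] at hDk
    push Not at hmin
    have := hK j (by omega)
    rw [div_lt_one (by positivity)] at this
    push_cast at hDk
    nlinarith
  have : ((Nat.find hex : ℕ) : ℝ) ≤ ((K + 1 : ℕ) : ℝ) := by exact_mod_cast hle
  nlinarith

/-- A rough geodesic, extended to the real line. -/
theorem IsRoughlyGeodesic.exists_path (h : IsRoughlyGeodesic X) :
    ∃ C : ℝ, 0 < C ∧ ∀ x y : X, ∃ (l : ℝ) (g : ℝ → X), 0 ≤ l ∧ g 0 = x ∧ g l = y ∧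
      ∀ s ∈ Icc 0 l, ∀ u ∈ Icc 0 l,
        |s - u| - C ≤ dist (g s) (g u) ∧ dist (g s) (g u) ≤ |s - u| + C := by
  obtain ⟨C, hC, h⟩ := h
  refine ⟨C, hC, fun x y => ?_⟩
  obtain ⟨l, hl, f, hf, h0, h1⟩ := h x y
  refine ⟨l, fun s => f (projIcc 0 l hl s), hl, ?_, ?_, fun s hs u hu => ?_⟩
  · simpa using h0
  · simpa using h1
  · have := hf ⟨s, hs⟩ ⟨u, hu⟩
    simp only [projIcc_of_mem hl hs, projIcc_of_mem hl hu]
    rw [Subtype.dist_eq, Real.dist_eq] at this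
    constructor <;> linarith [this.1, this.2]

/-- The metric part of a quasi-isometry. -/
def IsQuasiEmbedding (L C : ℝ) (f : X → Y) : Prop :=
  ∀ x y, L⁻¹ * dist x y - C ≤ dist (f x) (f y) ∧ dist (f x) (f y) ≤ L * dist x y + C

theorem IsQuasiEmbedding.dist_le {L C : ℝ} {f : X → Y} (hf : IsQuasiEmbedding L C f) (hL : 1 ≤ L)
    (x y : X) : dist x y ≤ L * (dist (f x) (f y) + C) := by
  have h := (hf x y).1
  have hL' : 0 < L := by linarith
  have := mul_le_mul_of_nonneg_left h hL'.le
  rw [mul_sub, ← mul_assoc, mul_inv_cancel₀ hL'.ne'] at this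
  linarith

/-- A rough geodesic with the end points of a quasi-geodesic stays close to it. -/
theorem exists_dist_le_of_roughGeodesic {L C C₁ C₂ δ : ℝ} (hL : 1 ≤ L) (hδ : 0 ≤ δ) (hC : 0 ≤ C)
    (hC₁ : 0 < C₁) (hC₂ : 0 < C₂)
    (h4 : ∀ x x' x'' y : Y,
      min (gromovProd x x' y) (gromovProd x' x'' y) - δ ≤ gromovProd x x'' y) :
    ∃ D₀ : ℝ, ∀ (f : X → Y), IsQuasiEmbedding L C f →
      ∀ (l m : ℝ) (g : ℝ → X) (h : ℝ → Y), 0 ≤ l → 0 ≤ m → f (g 0) = h 0 → f (g l) = h m →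
      (∀ s ∈ Icc 0 l, ∀ u ∈ Icc 0 l,
        |s - u| - C₁ ≤ dist (g s) (g u) ∧ dist (g s) (g u) ≤ |s - u| + C₁) →
      (∀ s ∈ Icc 0 m, ∀ u ∈ Icc 0 m,
        |s - u| - C₂ ≤ dist (h s) (h u) ∧ dist (h s) (h u) ≤ |s - u| + C₂) →
      ∀ s ∈ Icc 0 m, ∃ u ∈ Icc 0 l, dist (h s) (f (g u)) ≤ D₀ := by
  set A : ℝ := L * (1 + C₁) + C with hA
  obtain ⟨D₀, hD₀⟩ := exists_bound_of_le_log (6 * L) (L * (4 + 3 * C₂ + C) + C₁)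
    (1 + A / 2 + 3 * C₂ / 2 + 2 * δ) δ (by linarith) hδ
  refine ⟨D₀ + 1, fun f hf l m g h hl hm h0 h1 hg hh => ?_⟩
  have hne : (Icc (0 : ℝ) l).Nonempty := ⟨0, le_refl _, hl⟩
  set S : Set Y := (fun u => f (g u)) '' Icc 0 l with hS
  have hSne : S.Nonempty := hne.image _
  set E : ℝ → ℝ := fun s => Metric.infDist (h s) S with hE
  have h00 : f (g 0) ∈ S := ⟨0, ⟨le_refl _, hl⟩, rfl⟩
  have h1l : f (g l) ∈ S := ⟨l, ⟨hl, le_refl _⟩, rfl⟩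
  have hEb : BddAbove (E '' Icc 0 m) := by
    refine ⟨m + C₂, ?_⟩
    rintro _ ⟨s, hs, rfl⟩
    refine (Metric.infDist_le_dist_of_mem h00).trans ?_
    rw [h0]
    refine (hh s hs 0 ⟨le_refl _, hm⟩).2.trans ?_
    rw [sub_zero, abs_of_nonneg hs.1]
    linarith [hs.2]
  have hEne : (E '' Icc 0 m).Nonempty := ⟨_, 0, ⟨le_refl _, hm⟩, rfl⟩
  set D := sSup (E '' Icc 0 m) with hD
  have hED : ∀ s ∈ Icc 0 m, E s ≤ D := fun s hs => le_csSup hEb ⟨s, hs, rfl⟩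
  have hD0 : 0 ≤ D := Metric.infDist_nonneg.trans (hED 0 ⟨le_refl _, hm⟩)
  have near : ∀ s ∈ Icc 0 m, ∃ u ∈ Icc 0 l, dist (h s) (f (g u)) < D + 1 := by
    intro s hs
    have : Metric.infDist (h s) S < D + 1 := by linarith [hED s hs]
    obtain ⟨_, ⟨u, hu, rfl⟩, hlt⟩ := (Metric.infDist_lt_iff hSne).1 this
    exact ⟨u, hu, hlt⟩
  suffices hDD : D ≤ D₀ by
    intro s hs
    obtain ⟨u, hu, hlt⟩ := near s hs
    exact ⟨u, hu, by linarith⟩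
  -- The point `p` nearly realizes the largest distance `D`. A detour from `h s₁` to the
  -- quasi-geodesic, along it and back to `h s₂` avoids `p`, so the Gromov product of `h s₁` and `h
  -- s₂` at `p` is at least `D` minus the logarithm of a quantity linear in `D`, up to constants.
  -- Since `p` lies between these two points, the product is also bounded, hence so is `D`.
  obtain ⟨_, ⟨s, hs, rfl⟩, hsD⟩ := exists_lt_of_lt_csSup hEne (show D - 1 < D by linarith)
  set p := h s with hp
  have hfar : ∀ u ∈ Icc 0 l, D - 1 ≤ dist p (f (g u)) := fun u hu =>
    hsD.le.trans (Metric.infDist_le_dist_of_mem ⟨u, hu, rfl⟩)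
  -- At parameter distance `W` the point of `h` is at least `2 * D + 1` away from `p`; a jump of
  -- length at most `D + 1` to the quasi-geodesic then has Gromov product at least `D - 1` at `p`.
  set W := 2 * D + C₂ + 1 with hW
  -- points on both sides of `p`
  have left : ∃ s₁ ∈ Icc 0 m, ∃ u₁ ∈ Icc 0 l, s₁ ≤ s ∧ s - s₁ ≤ W ∧
      dist (h s₁) (f (g u₁)) ≤ D + 1 ∧ D - 1 ≤ gromovProd (h s₁) (f (g u₁)) p := by
    rcases le_total s W with hsW | hsW
    · refine ⟨0, ⟨le_refl _, hm⟩, 0, ⟨le_refl _, hl⟩, hs.1, by linarith, ?_, ?_⟩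
      · rw [h0, dist_self]; linarith
      · have := hfar 0 ⟨le_refl _, hl⟩
        unfold gromovProd
        rw [← h0, dist_self, dist_comm (f (g 0)) p]
        linarith
    · have hs1 : s - W ∈ Icc 0 m := ⟨by linarith, by linarith [hs.2]⟩
      obtain ⟨u, hu, hlt⟩ := near _ hs1
      refine ⟨s - W, hs1, u, hu, by linarith, by linarith, hlt.le, ?_⟩
      have e1 := (hh _ hs1 s hs).1
      rw [abs_sub_comm, show s - (s - W) = W by ring, abs_of_nonneg (by linarith)] at e1
      have := hfar u hu
      unfold gromovProd
      linarith
  have right : ∃ s₂ ∈ Icc 0 m, ∃ u₂ ∈ Icc 0 l, s ≤ s₂ ∧ s₂ - s ≤ W ∧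
      dist (h s₂) (f (g u₂)) ≤ D + 1 ∧ D - 1 ≤ gromovProd (f (g u₂)) (h s₂) p := by
    rcases le_total (m - s) W with hsW | hsW
    · refine ⟨m, ⟨hm, le_refl _⟩, l, ⟨hl, le_refl _⟩, hs.2, by linarith, ?_, ?_⟩
      · rw [h1, dist_self]; linarith
      · have := hfar l ⟨hl, le_refl _⟩
        unfold gromovProd
        rw [← h1, dist_self, dist_comm (f (g l)) p]
        linarith
    · have hs1 : s + W ∈ Icc 0 m := ⟨by linarith [hs.1], by linarith⟩
      obtain ⟨u, hu, hlt⟩ := near _ hs1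
      refine ⟨s + W, hs1, u, hu, by linarith, by linarith, hlt.le, ?_⟩
      have e1 := (hh s hs _ hs1).1
      rw [abs_sub_comm, show s + W - s = W by ring, abs_of_nonneg (by linarith)] at e1
      have := hfar u hu
      unfold gromovProd
      linarith [dist_comm (f (g u)) p, dist_comm (f (g u)) (h (s + W))]
  obtain ⟨s₁, hs₁, u₁, hu₁, hs₁s, hs₁W, hd₁, hp₁⟩ := left
  obtain ⟨s₂, hs₂, u₂, hu₂, hs₂s, hs₂W, hd₂, hp₂⟩ := right
  have hstep : ∀ v ∈ Icc 0 l, ∀ u ∈ Icc 0 l, |v - u| ≤ 1 → dist (f (g v)) (f (g u)) ≤ A := by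
    intro v hv u hu hvu
    have e1 := (hg v hv u hu).2
    have e2 := (hf (g v) (g u)).2
    have : L * dist (g v) (g u) ≤ L * (1 + C₁) :=
      mul_le_mul_of_nonneg_left (by linarith) (by linarith)
    linarith
  refine hD₀ D fun k hk => ?_
  have hu12 : |u₁ - u₂| ≤ 2 ^ k := by
    have e1 := (hg u₁ hu₁ u₂ hu₂).1
    have e2 := hf.dist_le hL (g u₁) (g u₂)
    have e3 : dist (f (g u₁)) (f (g u₂)) ≤ dist (h s₁) (f (g u₁)) + dist (h s₁) (h s₂)
        + dist (h s₂) (f (g u₂)) := by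
      have := dist_triangle4 (f (g u₁)) (h s₁) (h s₂) (f (g u₂))
      rwa [dist_comm (f (g u₁)) (h s₁)] at this
    have e4 := (hh s₁ hs₁ s₂ hs₂).2
    rw [abs_sub_comm, abs_of_nonneg (by linarith)] at e4
    have e5 : dist (f (g u₁)) (f (g u₂)) + C ≤ 6 * D + (4 + 3 * C₂ + C) := by linarith
    have := mul_le_mul_of_nonneg_left e5 (show 0 ≤ L by linarith)
    nlinarith
  have key := le_gromovProd_of_path h4 (fun u => f (g u)) p (Icc 0 l) ordConnected_Icc hstep hfar k
    u₁ hu₁ u₂ hu₂ hu12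
  have f1 := h4 (h s₁) (f (g u₁)) (f (g u₂)) p
  have f2 := h4 (h s₁) (f (g u₂)) (h s₂) p
  have hA0 : 0 ≤ A := by rw [hA]; nlinarith
  have hkδ : 0 ≤ k * δ := by positivity
  have m1 : D - 1 - A / 2 - k * δ ≤ min (gromovProd (h s₁) (f (g u₁)) p)
      (gromovProd (f (g u₁)) (f (g u₂)) p) := le_min (by linarith) (by linarith)
  have m2 : D - 1 - A / 2 - k * δ - δ ≤ min (gromovProd (h s₁) (f (g u₂)) p)
      (gromovProd (f (g u₂)) (h s₂) p) := le_min (by linarith) (by linarith)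
  have up : gromovProd (h s₁) (h s₂) p ≤ 3 * C₂ / 2 := by
    have e1 := (hh s₁ hs₁ s hs).2
    have e2 := (hh s hs s₂ hs₂).2
    have e3 := (hh s₁ hs₁ s₂ hs₂).1
    rw [abs_sub_comm, abs_of_nonneg (by linarith)] at e1 e2 e3
    unfold gromovProd
    linarith
  linarith

/-- In a hyperbolic space, two points that lie between `x` and `z` at the same distance from `x`
are close. -/
theorem dist_le_of_between {δ c e : ℝ}
    (h4 : ∀ x x' x'' y : Y,
      min (gromovProd x x' y) (gromovProd x' x'' y) - δ ≤ gromovProd x x'' y) {x z w p : Y}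
    (hw : dist x w + dist w z ≤ dist x z + c) (hp : dist x p + dist p z ≤ dist x z + c)
    (he : |dist x w - dist x p| ≤ e) : dist w p ≤ c + e + 2 * δ := by
  have := four_point_of_gromovProd h4 x z w p
  rw [dist_comm w x, dist_comm p x] at this
  rw [abs_le] at he
  rcases max_cases (dist x w + dist p z) (dist w z + dist x p) with ⟨h, _⟩ | ⟨h, _⟩ <;>
    rw [h] at this <;> linarith [he.1, he.2]

/-- The Morse lemma, in terms of Gromov products: quasi-isometric embeddings into a hyperbolic space
reflect the property of lying roughly between two points. -/
theorem IsQuasiEmbedding.exists_gromovProd_le {L C : ℝ} (hL : 1 ≤ L) (hC : 0 ≤ C) {f : X → Y}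
    (hf : IsQuasiEmbedding L C f) (hX : IsRoughlyGeodesic X) (hY : IsGromovHyperbolic Y) (c : ℝ) :
    ∃ c' : ℝ, ∀ x z w : X, gromovProd (f x) (f z) (f w) ≤ c → gromovProd x z w ≤ c' := by
  obtain ⟨hYg, δ, hδ, h4⟩ := hY
  obtain ⟨C₁, hC₁, hX⟩ := hX.exists_path
  obtain ⟨C₂, hC₂, hY⟩ := hYg.exists_path
  obtain ⟨D₀, hD₀⟩ := exists_dist_le_of_roughGeodesic (X := X) hL hδ hC hC₁ hC₂ h4
  refine ⟨3 * C₁ / 2 + L * ((max (2 * c) (3 * C₂)) + (2 * C₂ + 2 * |c|) + 2 * δ + D₀ + C),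
    fun x z w hw => ?_⟩
  obtain ⟨l, g, hl, hg0, hgl, hg⟩ := hX x z
  obtain ⟨m, h, hm, hh0, hhm, hh⟩ := hY (f x) (f z)
  -- The point of `h` roughly as far from `f x` as `f w` is; the minimum keeps the parameter in `[0,
  -- m]`.
  set s := min (dist (f x) (f w)) m with hs
  have hsm : s ∈ Icc 0 m := ⟨le_min dist_nonneg hm, min_le_right _ _⟩
  obtain ⟨u, hu, hd⟩ := hD₀ f hf l m g h hl hm (by rw [hg0, hh0]) (by rw [hgl, hhm]) hg hh s hsm
  have hm0 : (0 : ℝ) ∈ Icc 0 m := ⟨le_refl _, hm⟩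
  have hmm : m ∈ Icc 0 m := ⟨hm, le_refl _⟩
  have hl0 : (0 : ℝ) ∈ Icc 0 l := ⟨le_refl _, hl⟩
  have hll : l ∈ Icc 0 l := ⟨hl, le_refl _⟩
  have a1 := hh 0 hm0 s hsm
  have a2 := hh s hsm m hmm
  have a3 := hh 0 hm0 m hmm
  rw [abs_sub_comm, sub_zero, abs_of_nonneg hsm.1, hh0] at a1
  rw [abs_sub_comm, abs_of_nonneg (sub_nonneg.2 hsm.2), hhm] at a2
  rw [abs_sub_comm, sub_zero, abs_of_nonneg hm, hh0, hhm] at a3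
  unfold gromovProd at hw
  have hws : |dist (f x) (f w) - dist (f x) (h s)| ≤ 2 * C₂ + 2 * |c| := by
    have hc := le_abs_self c
    have hc' := abs_nonneg c
    have hwm : dist (f x) (f w) ≤ m + C₂ + 2 * c := by
      linarith [dist_nonneg (x := f w) (y := f z), a3.2]
    have hs1 : s ≤ dist (f x) (f w) := min_le_left _ _
    have hs2 : dist (f x) (f w) - C₂ - 2 * |c| ≤ s :=
      le_min (by linarith) (by linarith)
    rw [abs_le]
    constructor <;> linarith [a1.1, a1.2]
  have hclose := dist_le_of_between h4 (x := f x) (z := f z) (w := f w) (p := h s)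
    (c := max (2 * c) (3 * C₂)) (by linarith [le_max_left (2 * c) (3 * C₂)])
    (by linarith [le_max_right (2 * c) (3 * C₂), a1.2, a2.2, a3.1]) hws
  have hfin := hf.dist_le hL w (g u)
  have htri := dist_triangle (f w) (h s) (f (g u))
  have hfin' : dist w (g u) ≤
      L * ((max (2 * c) (3 * C₂)) + (2 * C₂ + 2 * |c|) + 2 * δ + D₀ + C) :=
    hfin.trans (mul_le_mul_of_nonneg_left (by linarith) (by linarith))
  have b1 := hg 0 hl0 u hu
  have b2 := hg u hu l hll
  have b3 := hg 0 hl0 l hll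
  rw [abs_sub_comm, sub_zero, abs_of_nonneg hu.1, hg0] at b1
  rw [abs_sub_comm, abs_of_nonneg (sub_nonneg.2 hu.2), hgl] at b2
  rw [abs_sub_comm, sub_zero, abs_of_nonneg hl, hg0, hgl] at b3
  refine (gromovProd_le_add_dist x z w (g u)).trans ?_
  have : gromovProd x z (g u) ≤ 3 * C₁ / 2 := by
    unfold gromovProd
    linarith [b1.2, b2.2, b3.1]
  linarith

/-- Triangles in a hyperbolic space have centers. -/
theorem IsGromovHyperbolic.exists_center (hY : IsGromovHyperbolic Y) :
    ∃ c : ℝ, ∀ x z p : Y, ∃ w, gromovProd x z w ≤ c ∧ gromovProd x p w ≤ c ∧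
      gromovProd z p w ≤ c := by
  obtain ⟨hYg, δ, hδ, h4⟩ := hY
  obtain ⟨C, hC, hY⟩ := hYg.exists_path
  refine ⟨δ + 3 * C, fun x z p => ?_⟩
  obtain ⟨m, h, hm, hh0, hhm, hh⟩ := hY x z
  have hm0 : (0 : ℝ) ∈ Icc 0 m := ⟨le_refl _, hm⟩
  have hmm : m ∈ Icc 0 m := ⟨hm, le_refl _⟩
  have a3 := hh 0 hm0 m hmm
  rw [abs_sub_comm, sub_zero, abs_of_nonneg hm, hh0, hhm] at a3
  -- In a tripod the center lies on the side from `x` to `z` at distance `(p | z)_x` from `x`.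
  set s := min (gromovProd p z x) m with hs
  have hg0 : 0 ≤ gromovProd p z x := by
    unfold gromovProd
    linarith [dist_triangle p x z]
  have hgm : gromovProd p z x ≤ m + C := by
    unfold gromovProd
    linarith [dist_triangle p z x, dist_comm x z, a3.2]
  have hsm : s ∈ Icc 0 m := ⟨le_min hg0 hm, min_le_right _ _⟩
  have hs1 : s ≤ gromovProd p z x := min_le_left _ _
  have hs2 : gromovProd p z x - C ≤ s := le_min (by linarith) (by linarith)
  have a1 := hh 0 hm0 s hsm
  have a2 := hh s hsm m hmm
  rw [abs_sub_comm, sub_zero, abs_of_nonneg hsm.1, hh0] at a1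
  rw [abs_sub_comm, abs_of_nonneg (sub_nonneg.2 hsm.2), hhm] at a2
  have hfour := four_point_of_gromovProd h4 x z (h s) p
  unfold gromovProd at hs1 hs2 ⊢
  rw [dist_comm (h s) x, dist_comm p x] at hfour
  rw [dist_comm p x] at hs1 hs2
  have hfour' : dist (h s) p + dist x z ≤
      (dist x z + dist x p + dist p z) / 2 + 3 * C + 2 * δ := by
    refine hfour.trans (add_le_add_left (max_le ?_ ?_) _)
    · linarith [a1.2]
    · linarith [a2.2, a3.1]
  refine ⟨h s, ?_, ?_, ?_⟩ <;> linarith [a1.2, a2.2, a3.1, dist_comm z (h s), dist_comm z p]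

/-- Gromov hyperbolicity of roughly geodesic spaces is a quasi-isometry invariant. -/
theorem IsGromovHyperbolic.of_quasiEmbedding {L C : ℝ} (hL : 1 ≤ L) (hC : 0 ≤ C) {f : X → Y}
    (hf : IsQuasiEmbedding L C f) (hsurj : Function.Surjective f) (hX : IsRoughlyGeodesic X)
    (hY : IsGromovHyperbolic Y) : IsGromovHyperbolic X := by
  obtain ⟨c, hc⟩ := hY.exists_center
  obtain ⟨c₁, hc₁⟩ := hf.exists_gromovProd_le hL hC hX hY c
  obtain ⟨δ, hδ, h4⟩ := hY.2
  obtain ⟨c₂, hc₂⟩ := hf.exists_gromovProd_le hL hC hX hY (c + δ)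
  refine ⟨hX, max 0 (c₂ + 2 * c₁), le_max_left _ _, fun x y z p => ?_⟩
  obtain ⟨w', h1, h2, h3⟩ := hc (f x) (f z) (f p)
  obtain ⟨w, rfl⟩ := hsurj w'
  have k2 := hc₁ _ _ _ h2
  have k3 := hc₁ _ _ _ h3
  -- Add the bounds for `(x | p)_w` and `(z | p)_w`.
  have hpw : dist p w ≤ gromovProd x z p + 2 * c₁ := by
    unfold gromovProd at *
    linarith [dist_triangle x w z, dist_comm w p, dist_comm p z, dist_comm w z]
  have hle := le_max_right 0 (c₂ + 2 * c₁)
  -- Since `f w` is roughly between `f x` and `f z`, the four-point inequality places it roughly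
  -- between `f y` and one of the two; the Morse lemma pulls this back to `w`.
  rcases min_le_iff.1 ((sub_le_iff_le_add.1 (h4 (f x) (f y) (f z) (f w))).trans
    (add_le_add_left h1 δ)) with h | h
  · have := (gromovProd_le_add_dist x y p w).trans (add_le_add_left (hc₂ _ _ _ h) _)
    linarith [min_le_left (gromovProd x y p) (gromovProd y z p)]
  · have := (gromovProd_le_add_dist y z p w).trans (add_le_add_left (hc₂ _ _ _ h) _)
    linarith [min_le_right (gromovProd x y p) (gromovProd y z p)]

/-- A symmetric function that satisfies the triangle inequality and is bounded at small scale grows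
at most linearly along rough geodesics. -/
theorem le_mul_of_roughGeodesic {C σ B l : ℝ} (hσ : 0 < σ) (hB : 0 ≤ B) (F : X → X → ℝ)
    (hF : ∀ x y z, F x z ≤ F x y + F y z)
    (hloc : ∀ x y, dist x y ≤ C + σ → F x y ≤ B) (g : ℝ → X)
    (hg : ∀ s ∈ Icc 0 l, ∀ u ∈ Icc 0 l, dist (g s) (g u) ≤ |s - u| + C) {s : ℝ}
    (hs : s ∈ Icc 0 l) : F (g 0) (g s) ≤ B * (s / σ + 1) := by
  have key : ∀ n : ℕ, ∀ s ∈ Icc 0 l, s ≤ n * σ → F (g 0) (g s) ≤ B * (s / σ + 1) := by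
    intro n
    induction n with
    | zero =>
      intro s hs hn
      have hs0 : s = 0 := le_antisymm (by simpa using hn) hs.1
      subst hs0
      have := hg 0 hs 0 hs
      simp only [sub_zero, abs_zero, zero_add] at this
      refine (hloc _ _ (by linarith)).trans ?_
      simp
    | succ n ih =>
      intro s hs hn
      rcases le_total s σ with h | h
      · have h0 : (0 : ℝ) ∈ Icc 0 l := ⟨le_refl _, hs.1.trans hs.2⟩
        have := hg 0 h0 s hs
        rw [zero_sub, abs_neg, abs_of_nonneg hs.1] at this
        refine (hloc _ _ (by linarith)).trans ?_
        have : 0 ≤ s / σ := div_nonneg hs.1 hσ.le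
        nlinarith
      · have hs' : s - σ ∈ Icc 0 l := ⟨by linarith, by linarith [hs.2]⟩
        push_cast at hn
        have h1 := ih _ hs' (by linarith)
        have h2 := hg _ hs' s hs
        rw [abs_sub_comm, show s - (s - σ) = σ by ring, abs_of_pos hσ] at h2
        have h3 := hF (g 0) (g (s - σ)) (g s)
        have h4 := hloc (g (s - σ)) (g s) (by linarith)
        rw [sub_div, div_self hσ.ne'] at h1
        linarith
  obtain ⟨n, hn⟩ := exists_nat_ge (s / σ)
  exact key n s hs ((div_le_iff₀ hσ).1 hn)

end Coarse

/-! ### The hyperbolic cone is roughly geodesic and hyperbolic. -/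

namespace HypCone

variable {H : Type*} [MetricSpace H]

/-- The numerator in the distance of the hyperbolic cone. -/
def num (p q : HPlus H) : ℝ := dist p.base q.base + max p.height q.height

theorem height_le_num_left (p q : HPlus H) : p.height ≤ num p q := by
  unfold num
  linarith [le_max_left p.height q.height, dist_nonneg (x := p.base) (y := q.base)]

theorem height_le_num_right (p q : HPlus H) : q.height ≤ num p q := by
  unfold num
  linarith [le_max_right p.height q.height, dist_nonneg (x := p.base) (y := q.base)]

theorem num_pos (p q : HPlus H) : 0 < num p q := p.height_pos.trans_le (height_le_num_left p q)

theorem num_comm (p q : HPlus H) : num p q = num q p := by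
  unfold num
  rw [dist_comm, max_comm]

theorem dist_base_le_num (p q : HPlus H) : dist p.base q.base ≤ num p q := by
  unfold num
  linarith [le_max_left p.height q.height, p.height_pos]

theorem num_triangle (p q r : HPlus H) : num p r ≤ num p q + num q r := by
  unfold num
  have := dist_triangle p.base q.base r.base
  have : max p.height r.height ≤ max p.height q.height + max q.height r.height :=
    max_le (by linarith [le_max_left p.height q.height, le_max_left q.height r.height,
      q.height_pos]) (by linarith [le_max_right p.height q.height, le_max_right q.height r.height,
      q.height_pos])
  linarith

theorem coneDist_eq (p q : HPlus H) :
    coneDist p q = 2 * Real.log (num p q) - Real.log p.height - Real.log q.height := by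
  have hp := p.height_pos
  have hq := q.height_pos
  have hn := num_pos p q
  unfold coneDist
  change 2 * Real.log (num p q / _) = _
  rw [Real.log_div hn.ne' (Real.sqrt_pos.2 (mul_pos hp hq)).ne', Real.log_sqrt (mul_pos hp hq).le,
    Real.log_mul hp.ne' hq.ne']
  ring

theorem dist_toCone (p q : HPlus H) : dist p.toCone q.toCone = coneDist p q := rfl

theorem abs_log_height_sub_le (p q : HPlus H) :
    |Real.log p.height - Real.log q.height| ≤ coneDist p q := by
  rw [coneDist_eq, abs_le]
  have h1 := Real.log_le_log p.height_pos (height_le_num_left p q)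
  have h2 := Real.log_le_log q.height_pos (height_le_num_right p q)
  constructor <;> linarith

theorem num_le_of_coneDist_le {p q : HPlus H} {R : ℝ} (h : coneDist p q ≤ R) :
    num p q ≤ Real.exp R * q.height := by
  rw [coneDist_eq] at h
  have h1 := Real.log_le_log p.height_pos (height_le_num_left p q)
  have : Real.log (num p q) ≤ R + Real.log q.height := by linarith
  rwa [← Real.log_exp R, ← Real.log_mul (Real.exp_pos _).ne' q.height_pos.ne',
    Real.log_le_log_iff (num_pos _ _) (mul_pos (Real.exp_pos _) q.height_pos)] at this

theorem coneDist_le_of_num_le {p q : HPlus H} {k : ℝ} (hk : 0 < k) (h₁ : num p q ≤ k * p.height)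
    (h₂ : num p q ≤ k * q.height) : coneDist p q ≤ 2 * Real.log k := by
  have e1 := Real.log_le_log (num_pos p q) h₁
  have e2 := Real.log_le_log (num_pos p q) h₂
  rw [Real.log_mul hk.ne' p.height_pos.ne'] at e1
  rw [Real.log_mul hk.ne' q.height_pos.ne'] at e2
  rw [coneDist_eq]
  linarith

theorem gromovProd_toCone (p q w : HPlus H) :
    gromovProd p.toCone q.toCone w.toCone =
      Real.log (num p w) + Real.log (num w q) - Real.log w.height - Real.log (num p q) := by
  unfold gromovProd
  rw [dist_toCone, dist_toCone, dist_toCone, coneDist_eq, coneDist_eq, coneDist_eq]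
  ring

/-- The dictionary between lying roughly between two points of the cone and a multiplicative
inequality for `num`. -/
theorem gromovProd_toCone_le_log_iff {p q w : HPlus H} {c : ℝ} (hc : 0 < c) :
    gromovProd p.toCone q.toCone w.toCone ≤ Real.log c ↔
      num p w * num w q ≤ c * w.height * num p q := by
  have h1 := num_pos p w
  have h2 := num_pos w q
  have h3 := num_pos p q
  have h4 := w.height_pos
  rw [← Real.log_le_log_iff (mul_pos h1 h2) (mul_pos (mul_pos hc h4) h3),
    Real.log_mul h1.ne' h2.ne', Real.log_mul (mul_pos hc h4).ne' h3.ne',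
    Real.log_mul hc.ne' h4.ne', gromovProd_toCone]
  constructor <;> intro h <;> linarith

/-- Regard `p, q, r, w` as a quadrilateral. Take the shorter side of each pair of opposite sides;
let the longer of these two belong to the pair `P`. By the triangle inequality the two diagonals are
at most twice the two sides of `P`, respectively. -/
theorem num_ptolemy (p q r w : HPlus H) :
    num p r * num q w ≤ 4 * max (num p q * num r w) (num q r * num p w) := by
  have hpq := num_pos p q
  have hrw := num_pos r w
  have hqr := num_pos q r
  have hpw := num_pos p w
  have hpr := num_pos p r
  have hqw := num_pos q w
  have t1 := num_triangle p q r
  have t2 := num_triangle p w r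
  have t3 := num_triangle q p w
  have t4 := num_triangle q r w
  rw [num_comm w r] at t2
  rw [num_comm q p] at t3
  have l1 := le_max_left (num p q * num r w) (num q r * num p w)
  have l2 := le_max_right (num p q * num r w) (num q r * num p w)
  rcases le_total (num p q) (num r w) with a | a <;> rcases le_total (num q r) (num p w) with b | b
  · rcases le_total (num p q) (num q r) with c | c
    · nlinarith [mul_le_mul (show num p r ≤ 2 * num q r by linarith)
        (show num q w ≤ 2 * num p w by linarith) hqw.le (by linarith)]
    · nlinarith [mul_le_mul (show num p r ≤ 2 * num p q by linarith)
        (show num q w ≤ 2 * num r w by linarith) hqw.le (by linarith)]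
  · rcases le_total (num p q) (num p w) with c | c
    · nlinarith [mul_le_mul (show num p r ≤ 2 * num q r by linarith)
        (show num q w ≤ 2 * num p w by linarith) hqw.le (by linarith)]
    · nlinarith [mul_le_mul (show num p r ≤ 2 * num r w by linarith)
        (show num q w ≤ 2 * num p q by linarith) hqw.le (by linarith)]
  · rcases le_total (num r w) (num q r) with c | c
    · nlinarith [mul_le_mul (show num p r ≤ 2 * num p w by linarith)
        (show num q w ≤ 2 * num q r by linarith) hqw.le (by linarith)]
    · nlinarith [mul_le_mul (show num p r ≤ 2 * num p q by linarith)
        (show num q w ≤ 2 * num r w by linarith) hqw.le (by linarith)]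
  · rcases le_total (num r w) (num p w) with c | c
    · nlinarith [mul_le_mul (show num p r ≤ 2 * num p w by linarith)
        (show num q w ≤ 2 * num q r by linarith) hqw.le (by linarith)]
    · nlinarith [mul_le_mul (show num p r ≤ 2 * num r w by linarith)
        (show num q w ≤ 2 * num p q by linarith) hqw.le (by linarith)]

/-- The logarithm of `num_ptolemy`; the heights cancel. -/
theorem four_point (p q r w : HPlus H) :
    min (gromovProd p.toCone q.toCone w.toCone) (gromovProd q.toCone r.toCone w.toCone)
      - Real.log 4 ≤ gromovProd p.toCone r.toCone w.toCone := by
  have hpq := num_pos p q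
  have hrw := num_pos r w
  have hqr := num_pos q r
  have hpw := num_pos p w
  have hpr := num_pos p r
  have hqw := num_pos q w
  have key := Real.log_le_log (by positivity) (num_ptolemy p q r w)
  rw [Real.log_mul hpr.ne' hqw.ne', Real.log_mul (by norm_num) (by positivity)] at key
  rw [gromovProd_toCone, gromovProd_toCone, gromovProd_toCone, num_comm w q, num_comm w r]
  rcases max_cases (num p q * num r w) (num q r * num p w) with ⟨h, _⟩ | ⟨h, _⟩
  · rw [h, Real.log_mul hpq.ne' hrw.ne'] at key
    refine (sub_le_sub_right (min_le_left _ _) _).trans ?_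
    linarith
  · rw [h, Real.log_mul hqr.ne' hpw.ne'] at key
    refine (sub_le_sub_right (min_le_right _ _) _).trans ?_
    linarith

/-- The point over `x` at logarithmic height `v`. -/
def vert {H : Type*} (x : H) (v : ℝ) : HPlus H := ⟨x, Real.exp v, Real.exp_pos v⟩

theorem coneDist_vert (x : H) (u v : ℝ) : coneDist (vert x u) (vert x v) = |u - v| := by
  rw [coneDist_eq]
  simp only [num, vert, dist_self, zero_add, Real.log_exp]
  rcases le_total u v with h | h
  · rw [max_eq_right (Real.exp_le_exp.2 h), Real.log_exp, abs_of_nonpos (by linarith)]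
    ring
  · rw [max_eq_left (Real.exp_le_exp.2 h), Real.log_exp, abs_of_nonneg (by linarith)]
    ring

/-- At level `e ^ m` the horizontal distance is comparable to the height, so going up to this level,
across and down is optimal up to a constant. The bounds on `b`, `u`, `v` place `num` between `e ^ m`
and `2 * e ^ m`, uniformly for heights on both vertical segments. -/
theorem coneDist_vert_vert {x y : H} {u v b m : ℝ} (hm : Real.exp m = dist x y + Real.exp b)
    (hu : u ≤ m) (hv : v ≤ m) (hb : b ≤ max u v) :
    2 * m - u - v ≤ coneDist (vert x u) (vert y v) ∧
      coneDist (vert x u) (vert y v) ≤ 2 * m - u - v + 2 * Real.log 2 := by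
  have hpos := num_pos (vert x u) (vert y v)
  have hmax : max (Real.exp u) (Real.exp v) = Real.exp (max u v) :=
    (Real.exp_monotone.map_max).symm
  have h1 : Real.exp m ≤ num (vert x u) (vert y v) := by
    simp only [num, vert]
    rw [hm, hmax]
    linarith [Real.exp_le_exp.2 hb]
  have h2 : num (vert x u) (vert y v) ≤ 2 * Real.exp m := by
    simp only [num, vert]
    rw [hmax]
    linarith [Real.exp_le_exp.2 (max_le hu hv), Real.exp_pos b]
  have e1 := Real.log_le_log (Real.exp_pos m) h1
  have e2 := Real.log_le_log hpos h2
  rw [Real.log_mul two_ne_zero (Real.exp_pos m).ne', Real.log_exp] at e2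
  rw [Real.log_exp] at e1
  rw [coneDist_eq]
  simp only [vert, Real.log_exp] at *
  constructor <;> linarith

theorem eq_vert {H : Type*} (p : HPlus H) : p = vert p.base (Real.log p.height) := by
  ext
  · rfl
  · exact (Real.exp_log p.height_pos).symm

/-- Rough geodesics ascend over `x` to the level of `coneDist_vert_vert`, jump over to `y`, and
descend. -/
theorem isRoughlyGeodesic : IsRoughlyGeodesic (HypCone H) := by
  refine ⟨2 * Real.log 2, by have := Real.log_pos one_lt_two; linarith, ?_⟩
  suffices h : ∀ p q : HPlus H, ∃ (l : ℝ) (hl : 0 ≤ l) (f : Icc (0 : ℝ) l → HypCone H),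
      IsRoughIsometry (2 * Real.log 2) f ∧ f ⟨0, le_refl 0, hl⟩ = p.toCone ∧
        f ⟨l, hl, le_refl l⟩ = q.toCone from h
  intro p q
  rw [eq_vert p, eq_vert q]
  generalize p.base = x
  generalize q.base = y
  generalize Real.log p.height = u
  generalize Real.log q.height = v
  have h2 := Real.log_pos one_lt_two
  set b := max u v with hb
  obtain ⟨m, hm⟩ : ∃ m, Real.exp m = dist x y + Real.exp b :=
    ⟨_, Real.exp_log (add_pos_of_nonneg_of_pos dist_nonneg (Real.exp_pos b))⟩
  have hbm : b ≤ m := Real.exp_le_exp.1 (by rw [hm]; linarith [dist_nonneg (x := x) (y := y)])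
  have hum : u ≤ m := (le_max_left _ _).trans hbm
  have hvm : v ≤ m := (le_max_right _ _).trans hbm
  have hl : 0 ≤ (m - u) + (m - v) := by linarith
  -- The general formula reaches the fibre over `y` only after the parameter `m - u`, so its end
  -- point requires `v < m`. If `m = v`, then `x = y` and a vertical segment suffices.
  by_cases hxy : x = y ∧ m = v
  · obtain ⟨rfl, rfl⟩ := hxy
    refine ⟨m - u, by linarith, fun s => (vert x (u + s)).toCone, fun s s' => ?_, ?_, ?_⟩
    · rw [dist_toCone, coneDist_vert, Subtype.dist_eq, Real.dist_eq, add_sub_add_left_eq_sub]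
      constructor <;> linarith
    · simp
    · simp
  have hlast : m = v → x = y := by
    intro h
    subst h
    have : dist x y ≤ 0 := by
      have := Real.exp_le_exp.2 (le_max_right u m)
      rw [← hb] at this
      linarith
    exact dist_le_zero.1 this
  have hvm' : v < m := lt_of_le_of_ne hvm fun h => hxy ⟨hlast h.symm, h.symm⟩
  refine ⟨(m - u) + (m - v), hl, fun s =>
    if (s : ℝ) ≤ m - u then (vert x (u + s)).toCone else (vert y (2 * m - u - s)).toCone, ?_, ?_, ?_⟩
  · have main : ∀ s s' : Icc (0 : ℝ) ((m - u) + (m - v)), (s : ℝ) ≤ m - u → ¬ (s' : ℝ) ≤ m - u →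
        -(2 * Real.log 2) + |(s : ℝ) - s'| ≤ coneDist (vert x (u + s)) (vert y (2 * m - u - s')) ∧
        coneDist (vert x (u + s)) (vert y (2 * m - u - s')) ≤ |(s : ℝ) - s'| + 2 * Real.log 2 := by
      intro s s' hs hs'
      have := coneDist_vert_vert (u := u + s) (v := 2 * m - u - s') hm (by linarith) (by linarith)
        (max_le_max (by linarith [s.2.1]) (by linarith [s'.2.2]))
      rw [abs_of_nonpos (by linarith)]
      constructor <;> linarith [this.1, this.2]
    intro s s'
    rw [Subtype.dist_eq, Real.dist_eq]
    by_cases h : (s : ℝ) ≤ m - u <;> by_cases h' : (s' : ℝ) ≤ m - u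
    · simp only [h, h', if_true, dist_toCone]
      rw [coneDist_vert, add_sub_add_left_eq_sub]
      constructor <;> linarith
    · simp only [h, h', if_true, if_false, dist_toCone]
      exact main s s' h h'
    · simp only [h, h', if_true, if_false, dist_toCone]
      rw [coneDist_comm, abs_sub_comm]
      exact main s' s h' h
    · simp only [h, h', if_false, dist_toCone]
      rw [coneDist_vert, sub_sub_sub_cancel_left, abs_sub_comm]
      constructor <;> linarith
  · simp [hum]
  · have : ¬ ((m - u) + (m - v) ≤ m - u) := by linarith
    simp only [this, if_false]
    congr 2
    ring

theorem isGromovHyperbolic : IsGromovHyperbolic (HypCone H) :=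
  ⟨isRoughlyGeodesic, Real.log 4, Real.log_nonneg (by norm_num), fun p q r w => four_point p q r w⟩

end HypCone

/-! ### Rough geodesics in Riemannian manifolds. -/

section Length

variable {E : Type*} [NormedAddCommGroup E] [NormedSpace ℝ E] {F : Type*} [TopologicalSpace F]
  {M : Type*} [MetricSpace M] [ChartedSpace F M]

/-- Points of a Riemannian manifold are joined by a path with a length function whose total length
exceeds the distance of the end points by an arbitrarily small amount. -/
theorem exists_path_almost_minimizing (I : ModelWithCorners ℝ E F)
    [RiemannianBundle (fun p : M => TangentSpace I p)] [IsRiemannianManifold I M]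
    (x y : M) {ε : ℝ} (hε : 0 < ε) :
    ∃ (γ : ℝ → M) (len : ℝ → ℝ), γ 0 = x ∧ γ 1 = y ∧ ContinuousOn γ (Icc 0 1) ∧
      (∀ s ∈ Icc (0 : ℝ) 1, ∀ u ∈ Icc (0 : ℝ) 1, s ≤ u → dist (γ s) (γ u) ≤ len u - len s) ∧
      len 1 - len 0 ≤ dist x y + ε := by
  have hlt : riemannianEDist I x y < ENNReal.ofReal (dist x y + ε) := by
    rw [← IsRiemannianManifold.out (I := I) x y, edist_dist]
    exact (ENNReal.ofReal_lt_ofReal_iff (by positivity)).2 (by linarith)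
  obtain ⟨γ, h0, h1, hγ, hlen⟩ := exists_lt_of_riemannianEDist_lt hlt
  have hfin : ∀ s ∈ Icc (0 : ℝ) 1, ∀ u ∈ Icc (0 : ℝ) 1, pathELength I γ s u ≠ ⊤ :=
    fun s hs u hu => ne_top_of_le_ne_top hlen.ne_top (pathELength_mono hs.1 hu.2)
  have z : (0 : ℝ) ∈ Icc (0 : ℝ) 1 := ⟨le_refl _, zero_le_one⟩
  have o : (1 : ℝ) ∈ Icc (0 : ℝ) 1 := ⟨zero_le_one, le_refl _⟩
  refine ⟨γ, fun u => (pathELength I γ 0 u).toReal, h0, h1, hγ.continuousOn,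
    fun s hs u hu hsu => ?_, ?_⟩
  · have hadd := pathELength_add (I := I) (γ := γ) hs.1 hsu
    have hle : edist (γ s) (γ u) ≤ pathELength I γ s u := by
      rw [IsRiemannianManifold.out (I := I) (γ s) (γ u)]
      exact riemannianEDist_le_pathELength (hγ.mono (Icc_subset_Icc hs.1 hu.2)) rfl rfl hsu
    simp only
    rw [← hadd, ENNReal.toReal_add (hfin 0 z s hs) (hfin s hs u hu), add_sub_cancel_left,
      dist_edist]
    exact ENNReal.toReal_mono (hfin s hs u hu) hle
  · simp only [pathELength_self, ENNReal.toReal_zero, sub_zero]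
    exact ENNReal.toReal_le_of_le_ofReal (by positivity) hlen.le

/-- Points of a Riemannian manifold are joined by rough geodesics with an arbitrarily small
constant. -/
theorem exists_roughGeodesic (I : ModelWithCorners ℝ E F)
    [RiemannianBundle (fun p : M => TangentSpace I p)] [IsRiemannianManifold I M]
    (x y : M) {ε : ℝ} (hε : 0 < ε) :
    ∃ g : ℝ → M, g 0 = x ∧ g (dist x y) = y ∧ ∀ s ∈ Icc 0 (dist x y), ∀ u ∈ Icc 0 (dist x y),
      |s - u| ≤ dist (g s) (g u) ∧ dist (g s) (g u) ≤ |s - u| + ε := by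
  obtain ⟨γ, len, h0, h1, hγ, hlen, htot⟩ := exists_path_almost_minimizing I x y hε
  have z : (0 : ℝ) ∈ Icc (0 : ℝ) 1 := ⟨le_refl _, zero_le_one⟩
  have o : (1 : ℝ) ∈ Icc (0 : ℝ) 1 := ⟨zero_le_one, le_refl _⟩
  -- Parametrize by the distance from `x`. Other points of the path may also have distance `dist x
  -- y` from `x`, so the value `τ = 1` is forced there to end at `y`.
  have hivt : ∀ s : ℝ, ∃ τ ∈ Icc (0 : ℝ) 1, s ∈ Icc 0 (dist x y) →
      dist x (γ τ) = s ∧ (s = dist x y → τ = 1) := by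
    intro s
    by_cases hs : s ∈ Icc 0 (dist x y)
    · rcases eq_or_ne s (dist x y) with rfl | hne
      · exact ⟨1, o, fun _ => ⟨by rw [h1], fun _ => rfl⟩⟩
      · have hc : ContinuousOn (fun τ => dist x (γ τ)) (Icc 0 1) := (continuous_const.dist continuous_id).comp_continuousOn hγ
        have hs' : s ∈ Icc (dist x (γ 0)) (dist x (γ 1)) := by rwa [h0, h1, dist_self]
        obtain ⟨τ, hτ, he⟩ := intermediate_value_Icc zero_le_one hc hs'
        exact ⟨τ, hτ, fun _ => ⟨he, fun h => absurd h hne⟩⟩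
    · exact ⟨0, z, fun h => absurd h hs⟩
  choose τ hτ hτs using hivt
  have key : ∀ s ∈ Icc 0 (dist x y), ∀ u ∈ Icc 0 (dist x y), τ s ≤ τ u →
      dist (γ (τ s)) (γ (τ u)) ≤ |s - u| + ε := by
    intro s hs u hu hsu
    -- The three pieces of the path have total length at most `dist x y + ε`; the outer ones have
    -- length at least `s` and `dist x y - u`.
    have e1 := hlen 0 z (τ s) (hτ s) (hτ s).1
    have e2 := hlen (τ s) (hτ s) (τ u) (hτ u) hsu
    have e3 := hlen (τ u) (hτ u) 1 o (hτ u).2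
    rw [h0, (hτs s hs).1] at e1
    rw [h1] at e3
    have e4 := dist_triangle x (γ (τ u)) y
    rw [(hτs u hu).1] at e4
    linarith [neg_abs_le (s - u)]
  refine ⟨fun s => γ (τ s), ?_, ?_, fun s hs u hu => ⟨?_, ?_⟩⟩
  · exact (dist_eq_zero.1 (hτs 0 ⟨le_refl _, dist_nonneg⟩).1).symm
  · have := (hτs (dist x y) ⟨dist_nonneg, le_refl _⟩).2 rfl
    simp only [this, h1]
  · have e1 := (hτs s hs).1
    have e2 := (hτs u hu).1
    have e3 := dist_triangle x (γ (τ s)) (γ (τ u))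
    have e4 := dist_triangle x (γ (τ u)) (γ (τ s))
    rw [dist_comm (γ (τ u))] at e4
    rw [abs_le]
    constructor <;> linarith
  · rcases le_total (τ s) (τ u) with h | h
    · exact key s hs u hu h
    · rw [dist_comm, abs_sub_comm]
      exact key u hu s hs h

theorem isRoughlyGeodesic_of_riemannian (I : ModelWithCorners ℝ E F)
    [RiemannianBundle (fun p : M => TangentSpace I p)] [IsRiemannianManifold I M] :
    IsRoughlyGeodesic M := by
  refine ⟨1, one_pos, fun x y => ?_⟩
  obtain ⟨g, h0, h1, hg⟩ := exists_roughGeodesic I x y one_pos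
  refine ⟨dist x y, dist_nonneg, fun s => g s, fun s u => ?_, h0, h1⟩
  have := hg s s.2 u u.2
  rw [Subtype.dist_eq, Real.dist_eq]
  constructor <;> linarith [this.1, this.2]

end Length

/-! ### The homothety: fixed point, powers, compact balls. -/

namespace StackedTiling

variable {n : ℕ} {H : Type*} [MetricSpace H] (T : StackedTiling n H)

theorem a_pos : 0 < T.a := one_pos.trans T.one_lt_a

/-- The inverse of `α` is a contraction of a complete space. -/
theorem exists_fixedPoint : ∃ x, T.α x = x := by
  have := T.complete
  obtain ⟨x₀, -⟩ := T.K_interior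
  have : Nonempty H := ⟨x₀⟩
  have ha := T.a_pos
  have hc : ContractingWith T.a⁻¹.toNNReal T.α.symm := by
    refine ⟨?_, LipschitzWith.of_dist_le_mul fun x y => ?_⟩
    · rw [Real.toNNReal_lt_one]
      exact inv_lt_one_of_one_lt₀ T.one_lt_a
    · have := T.dist_α (T.α.symm x) (T.α.symm y)
      simp only [Equiv.apply_symm_apply] at this
      rw [Real.coe_toNNReal _ (inv_pos.2 ha).le, this, inv_mul_cancel_left₀ ha.ne']
  refine ⟨hc.fixedPoint _, ?_⟩
  have := hc.fixedPoint_isFixedPt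
  rw [Function.IsFixedPt, Equiv.symm_apply_eq] at this
  exact this.symm

/-- The powers of the homothety. -/
def αpow (k : ℤ) : Equiv.Perm H := (show Equiv.Perm H from T.α) ^ k

theorem αpow_zero (x : H) : T.αpow 0 x = x := by simp [αpow]

theorem αpow_add (k l : ℤ) (x : H) : T.αpow (k + l) x = T.αpow k (T.αpow l x) := by
  simp [αpow, zpow_add]

theorem αpow_one (x : H) : T.αpow 1 x = T.α x := by
  unfold αpow
  rw [zpow_one]

theorem dist_αpow (k : ℤ) (x y : H) : dist (T.αpow k x) (T.αpow k y) = T.a ^ k * dist x y := by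
  have ha := T.a_pos
  induction k using Int.induction_on with
  | zero => simp [αpow_zero]
  | succ k ih =>
    rw [add_comm, αpow_add, αpow_add, αpow_one, αpow_one, dist_α, ih, zpow_add₀ ha.ne', zpow_one]
    ring
  | pred k ih =>
    have e : (-(k : ℤ)) = 1 + (-(k : ℤ) - 1) := by ring
    rw [e, αpow_add, αpow_add, αpow_one, αpow_one, dist_α, zpow_add₀ ha.ne', zpow_one,
      mul_assoc] at ih
    exact mul_left_cancel₀ ha.ne' ih

theorem αpow_fixed {x : H} (hx : T.α x = x) (k : ℤ) : T.αpow k x = x := by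
  induction k using Int.induction_on with
  | zero => exact T.αpow_zero x
  | succ k ih => rw [add_comm, αpow_add, ih, αpow_one, hx]
  | pred k ih =>
    have e : (-(k : ℤ)) = 1 + (-(k : ℤ) - 1) := by ring
    rw [e, αpow_add, αpow_one] at ih
    exact T.α.injective (ih.trans hx.symm)

/-- Local compactness, inherited from `ℝⁿ`, gives a small compact ball around the fixed point;
powers of `α` enlarge it. -/
theorem isCompact_closedBall {x : H} (hx : T.α x = x) (R : ℝ) :
    IsCompact (Metric.closedBall x R) := by
  have ha := T.a_pos
  obtain ⟨φ⟩ := T.homeo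
  have : LocallyCompactSpace H := φ.isClosedEmbedding.locallyCompactSpace
  obtain ⟨C, hC, hxC⟩ := exists_compact_mem_nhds x
  obtain ⟨r, hr, hrC⟩ := Metric.nhds_basis_closedBall.mem_iff.1 hxC
  obtain ⟨k, hk⟩ := pow_unbounded_of_one_lt (R / r) T.one_lt_a
  rw [div_lt_iff₀ hr] at hk
  have hcont : Continuous (T.αpow k) := by
    refine (LipschitzWith.of_dist_le_mul (K := (T.a ^ (k : ℤ)).toNNReal)
      fun y z => ?_).continuous
    rw [Real.coe_toNNReal _ (zpow_pos ha _).le]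
    exact (T.dist_αpow k y z).le
  refine (hC.image hcont).of_isClosed_subset Metric.isClosed_closedBall fun y hy => ?_
  refine ⟨T.αpow (-k) y, hrC ?_, ?_⟩
  · rw [Metric.mem_closedBall] at hy ⊢
    have := T.dist_αpow (-k) y x
    rw [T.αpow_fixed hx, zpow_neg, zpow_natCast] at this
    rw [this, inv_mul_le_iff₀ (pow_pos ha _)]
    linarith
  · rw [← αpow_add, add_neg_cancel, αpow_zero]

end StackedTiling

/-- `g` preserves both distances on `H × (0, ∞)` and multiplies the height by `c`. -/
structure IsSymmetry {H : Type*} [MetricSpace H] [MetricSpace (HPlus H)]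
    (g : HPlus H → HPlus H) (c : ℝ) : Prop where
  pos : 0 < c
  height : ∀ p, (g p).height = c * p.height
  dist_eq : ∀ p q, dist (g p) (g q) = dist p q
  coneDist_eq : ∀ p q, HypCone.coneDist (g p) (g q) = HypCone.coneDist p q

theorem HypCone.coneDist_map {H : Type*} [MetricSpace H] {f : H → H} {c : ℝ} (hc : 0 < c)
    (hf : ∀ x y, dist (f x) (f y) = c * dist x y) (p q : HPlus H) :
    coneDist (p.map f c hc) (q.map f c hc) = coneDist p q := by
  have hp := p.height_pos
  have hq := q.height_pos
  have : num (p.map f c hc) (q.map f c hc) = c * num p q := by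
    simp only [num, HPlus.map, hf, mul_add, mul_max_of_nonneg _ _ hc.le]
  rw [coneDist_eq, coneDist_eq, this, Real.log_mul hc.ne' (num_pos p q).ne']
  simp only [HPlus.map]
  rw [Real.log_mul hc.ne' hp.ne', Real.log_mul hc.ne' hq.ne']
  ring

/-! ### Symmetries, and the quasi-isometry to the cone. -/

namespace IsMetricSimilaritySpace

variable {n : ℕ} {H : Type*} [MetricSpace H] [MetricSpace (HPlus H)] {T : StackedTiling n H}
  (hT : IsMetricSimilaritySpace T)

include hT

theorem isSymmetry_Γ {γ : H ≃ᵢ H} (hγ : γ ∈ T.Γ) : IsSymmetry (HPlus.map (H := H) γ 1 one_pos) 1 :=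
  ⟨one_pos, fun _ => rfl, (hT.isometry_Γ γ hγ).dist_eq,
    HypCone.coneDist_map one_pos fun x y => by rw [γ.dist_eq, one_mul]⟩

theorem isSymmetry_α (k : ℤ) :
    IsSymmetry (HPlus.map (H := H) (T.αpow k) (T.a ^ k) (zpow_pos T.a_pos k)) (T.a ^ k) := by
  have ha := T.a_pos
  have hstep : ∀ (k : ℤ) (p : HPlus H), p.map (T.αpow (1 + k)) (T.a ^ (1 + k)) (zpow_pos ha _) =
      (p.map (T.αpow k) (T.a ^ k) (zpow_pos ha k)).map T.α T.a ha := by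
    intro k p
    ext
    · simp only [HPlus.map, T.αpow_add, T.αpow_one]
    · simp only [HPlus.map, zpow_add₀ ha.ne', zpow_one, mul_assoc]
  refine ⟨zpow_pos ha k, fun _ => rfl, fun p q => ?_,
    HypCone.coneDist_map _ (T.dist_αpow k)⟩
  induction k using Int.induction_on with
  | zero =>
    have : ∀ p : HPlus H, p.map (T.αpow 0) (T.a ^ (0 : ℤ)) (zpow_pos ha 0) = p := by
      intro p
      ext
      · simp only [HPlus.map, T.αpow_zero]
      · simp only [HPlus.map, zpow_zero, one_mul]
    rw [this, this]
  | succ k ih =>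
    have h := hstep k
    rw [add_comm] at h
    rw [h, h, hT.isometry_α.dist_eq, ih]
  | pred k ih =>
    have h := hstep (-(k : ℤ) - 1)
    have e : 1 + (-(k : ℤ) - 1) = -(k : ℤ) := by ring
    simp only [e] at h
    rw [h, h, hT.isometry_α.dist_eq] at ih
    exact ih

omit [MetricSpace (HPlus H)] hT in
/-- The symmetries move every point into `K × [1, a]`. -/
theorem exists_map_mem_core (T : StackedTiling n H) (w : HPlus H) : ∃ k : ℤ, ∃ γ ∈ T.Γ,
    γ (T.αpow k w.base) ∈ T.K ∧ T.a ^ k * w.height ∈ Icc 1 T.a := by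
  have ha := T.a_pos
  obtain ⟨m, hm1, hm2⟩ := exists_mem_Ico_zpow w.height_pos T.one_lt_a
  have hcov : T.αpow (-m) w.base ∈ ⋃ γ ∈ T.Γ, γ '' T.K := by rw [T.cover]; trivial
  simp only [mem_iUnion] at hcov
  obtain ⟨γ, hγ, y, hy, hyw⟩ := hcov
  refine ⟨-m, γ⁻¹, T.Γ.inv_mem hγ, ?_, ?_, ?_⟩
  · rw [← hyw]
    change γ.symm (γ y) ∈ T.K
    rwa [γ.symm_apply_apply]
  · rw [zpow_neg, ← div_eq_inv_mul, le_div_iff₀ (zpow_pos ha _), one_mul]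
    exact hm1
  · rw [zpow_neg, ← div_eq_inv_mul, div_le_iff₀ (zpow_pos ha _)]
    rw [zpow_add₀ ha.ne', zpow_one, mul_comm] at hm2
    exact hm2.le

theorem continuous_base : Continuous (fun p : HPlus H => p.base) :=
  continuous_fst.comp hT.product_topology.continuous

theorem continuous_height : Continuous (fun p : HPlus H => p.height) :=
  continuous_subtype_val.comp (continuous_snd.comp hT.product_topology.continuous)

theorem continuous_coneDist : Continuous (fun p : HPlus H × HPlus H => HypCone.coneDist p.1 p.2) := by
  have hb := hT.continuous_base
  have hh := hT.continuous_height
  have h1 : Continuous (fun p : HPlus H × HPlus H => HypCone.num p.1 p.2) := by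
    unfold HypCone.num
    exact ((hb.comp continuous_fst).dist (hb.comp continuous_snd)).add
      ((hh.comp continuous_fst).max (hh.comp continuous_snd))
  simp only [HypCone.coneDist_eq]
  refine (((continuous_const.mul (h1.log fun p => (HypCone.num_pos _ _).ne'))).sub
    ((hh.comp continuous_fst).log fun p => p.1.height_pos.ne')).sub
    ((hh.comp continuous_snd).log fun p => p.2.height_pos.ne')

theorem isCompact_box {C : Set H} (hC : IsCompact C) {r₁ r₂ : ℝ} (hr : 0 < r₁) :
    IsCompact {p : HPlus H | p.base ∈ C ∧ p.height ∈ Icc r₁ r₂} := by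
  have hI : IsCompact {s : Ioi (0 : ℝ) | (s : ℝ) ∈ Icc r₁ r₂} := by
    rw [Subtype.isCompact_iff]
    convert isCompact_Icc (a := r₁) (b := r₂) using 1
    ext s
    constructor
    · rintro ⟨s, hs, rfl⟩
      exact hs
    · intro hs
      exact ⟨⟨s, hr.trans_le hs.1⟩, hs, rfl⟩
  exact (hT.product_topology.homeomorph).isCompact_preimage.2 (hC.prod hI)

/-- At small scale the distance of `H⁺` controls that of the cone. -/
theorem exists_coneDist_le_one :
    ∃ r : ℝ, 0 < r ∧ ∀ p q : HPlus H, dist p q ≤ r → HypCone.coneDist p q ≤ 1 := by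
  have hcore := hT.isCompact_box T.K_compact one_pos (r₂ := T.a)
  have hdiag := hcore.image (f := fun p : HPlus H => (p, p)) (by fun_prop)
  have hU : IsOpen {p : HPlus H × HPlus H | HypCone.coneDist p.1 p.2 < 1} :=
    isOpen_lt hT.continuous_coneDist continuous_const
  -- Over the compact core, a uniform neighborhood of the diagonal lies where the cone distance is
  -- below 1; the symmetries carry this to all points.
  obtain ⟨δ, hδ, hsub⟩ := hdiag.exists_thickening_subset_open hU (by
    rintro _ ⟨p, -, rfl⟩
    simp [HypCone.coneDist_self])
  refine ⟨δ / 2, half_pos hδ, fun p q hpq => ?_⟩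
  obtain ⟨k, γ, hγ, hK, hh⟩ := exists_map_mem_core T p
  have h1 := hT.isSymmetry_α k
  have h2 := hT.isSymmetry_Γ hγ
  rw [← h1.coneDist_eq, ← h2.coneDist_eq]
  rw [← h1.dist_eq, ← h2.dist_eq] at hpq
  generalize hp' : HPlus.map γ 1 one_pos (HPlus.map (T.αpow k) (T.a ^ k) (zpow_pos T.a_pos k) p)
    = p' at *
  generalize HPlus.map γ 1 one_pos (HPlus.map (T.αpow k) (T.a ^ k) (zpow_pos T.a_pos k) q)
    = q' at *
  have hmem : p' ∈ {p : HPlus H | p.base ∈ T.K ∧ p.height ∈ Icc 1 T.a} := by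
    rw [← hp']
    refine ⟨hK, ?_⟩
    simpa [HPlus.map] using hh
  refine le_of_lt (@hsub (p', q') ?_)
  rw [Metric.mem_thickening_iff]
  refine ⟨(p', p'), ⟨p', hmem, rfl⟩, ?_⟩
  rw [Prod.dist_eq]
  simp only [dist_self]
  rw [max_eq_right dist_nonneg, dist_comm]
  linarith

/-- The distance of the cone controls that of `H⁺`. -/
theorem exists_dist_le_of_coneDist_le (R : ℝ) :
    ∃ B : ℝ, 0 ≤ B ∧ ∀ p q : HPlus H, HypCone.coneDist p q ≤ R → dist p q ≤ B := by
  obtain ⟨x, hx⟩ := T.exists_fixedPoint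
  obtain ⟨ρ, hρ⟩ := T.K_compact.isBounded.subset_closedBall x
  -- Points at cone distance at most `R` from the core lie over a fixed ball, at heights bounded
  -- away from 0 and `∞`; this box is compact, hence bounded in `H⁺`.
  have hbox := hT.isCompact_box (T.isCompact_closedBall hx (ρ + Real.exp R * T.a))
    (r₁ := min 1 (Real.exp R)⁻¹) (r₂ := max T.a (Real.exp R * T.a))
    (lt_min one_pos (inv_pos.2 (Real.exp_pos R)))
  obtain ⟨B, hB⟩ := Metric.isBounded_iff.1 hbox.isBounded
  refine ⟨max B 0, le_max_right _ _, fun p q hpq => ?_⟩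
  obtain ⟨k, γ, hγ, hK, hh⟩ := exists_map_mem_core T p
  have h1 := hT.isSymmetry_α k
  have h2 := hT.isSymmetry_Γ hγ
  rw [← h1.coneDist_eq, ← h2.coneDist_eq] at hpq
  rw [← h1.dist_eq, ← h2.dist_eq]
  generalize hp' : HPlus.map γ 1 one_pos (HPlus.map (T.αpow k) (T.a ^ k) (zpow_pos T.a_pos k) p)
    = p' at *
  generalize HPlus.map γ 1 one_pos (HPlus.map (T.αpow k) (T.a ^ k) (zpow_pos T.a_pos k) q)
    = q' at *
  have hpK : p'.base ∈ T.K := by rw [← hp']; exact hK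
  have hph : p'.height ∈ Icc 1 T.a := by rw [← hp']; simpa [HPlus.map] using hh
  have hE := Real.exp_pos R
  have hpx := Metric.mem_closedBall.1 (hρ hpK)
  have n1 := HypCone.num_le_of_coneDist_le hpq
  rw [HypCone.coneDist_comm] at hpq
  have n2 := HypCone.num_le_of_coneDist_le hpq
  have n3 : HypCone.num q' p' ≤ Real.exp R * T.a :=
    n2.trans (mul_le_mul_of_nonneg_left hph.2 hE.le)
  refine (hB ⟨?_, ?_, ?_⟩ ⟨?_, ?_, ?_⟩).trans (le_max_left _ _)
  · rw [Metric.mem_closedBall]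
    linarith [mul_pos hE T.a_pos]
  · exact (min_le_left _ _).trans hph.1
  · exact hph.2.trans (le_max_left _ _)
  · rw [Metric.mem_closedBall]
    linarith [dist_triangle q'.base p'.base x, HypCone.dist_base_le_num q' p']
  · refine (min_le_right _ _).trans ?_
    rw [inv_le_iff_one_le_mul₀ hE, mul_comm]
    linarith [hph.1, HypCone.height_le_num_left p' q']
  · exact ((HypCone.height_le_num_left q' p').trans n3).trans (le_max_right _ _)

/-- The identity map to the cone is a quasi-isometry as soon as `H⁺` is a length space. -/
theorem exists_isQuasiEmbedding
    (hlen : ∀ (p q : HPlus H) {ε : ℝ}, 0 < ε → ∃ g : ℝ → HPlus H, g 0 = p ∧ g (dist p q) = q ∧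
      ∀ s ∈ Icc 0 (dist p q), ∀ u ∈ Icc 0 (dist p q),
        |s - u| ≤ dist (g s) (g u) ∧ dist (g s) (g u) ≤ |s - u| + ε) :
    ∃ L C : ℝ, 1 ≤ L ∧ 0 ≤ C ∧ IsQuasiEmbedding L C (HPlus.toCone : HPlus H → HypCone H) := by
  obtain ⟨r, hr, hr1⟩ := hT.exists_coneDist_le_one
  obtain ⟨C, hC, hpath⟩ := (HypCone.isRoughlyGeodesic (H := H)).exists_path
  obtain ⟨B, hB, hB1⟩ := hT.exists_dist_le_of_coneDist_le (C + 1)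
  have h2r : 0 < 2 / r := by positivity
  refine ⟨1 + 2 / r + B, C + 2, by linarith, by linarith, fun p q => ⟨?_, ?_⟩⟩
  -- Follow a rough geodesic of the cone in unit steps, each of length at most `B` in `H⁺`.
  · obtain ⟨l, g, hl, h0, h1, hg⟩ := hpath p.toCone q.toCone
    have h := le_mul_of_roughGeodesic one_pos hB
      (fun p q : HypCone H => @dist (HPlus H) _ p q) (fun x y z => dist_triangle (α := HPlus H) x y z)
      (fun x y h => hB1 x y h) g (fun s hs u hu => (hg s hs u hu).2) (s := l) ⟨hl, le_refl _⟩
    have hl' := (hg 0 ⟨le_refl _, hl⟩ l ⟨hl, le_refl _⟩).1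
    rw [zero_sub, abs_neg, abs_of_nonneg hl] at hl'
    rw [h0, h1] at h hl'
    change dist p q ≤ _ at h
    rw [sub_le_iff_le_add, inv_mul_le_iff₀ (by linarith)]
    refine h.trans (mul_le_mul (by linarith) ?_ ?_ (by linarith))
    · rw [div_one]; linarith
    · rw [div_one]; linarith
  -- Conversely, follow a rough geodesic of `H⁺`: parameter step `r / 2` plus error `r / 2` stays
  -- within the scale `r`.
  · obtain ⟨g, h0, h1, hg⟩ := hlen p q (half_pos hr)
    have h := le_mul_of_roughGeodesic (half_pos hr) zero_le_one
      (fun p q : HPlus H => HypCone.coneDist p q) HypCone.coneDist_triangle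
      (fun x y h => hr1 x y (by linarith)) g (fun s hs u hu => (hg s hs u hu).2)
      (s := dist p q) ⟨dist_nonneg, le_refl _⟩
    rw [h0, h1] at h
    rw [HypCone.dist_toCone]
    refine h.trans ?_
    have e : dist p q / (r / 2) = 2 / r * dist p q := by
      field_simp
    rw [e]
    nlinarith [dist_nonneg (x := p) (y := q), mul_nonneg hB (dist_nonneg (x := p) (y := q))]

end IsMetricSimilaritySpace

/-! ### Hausdorff distance and rough rays -/

section Hausdorff

variable {X S T : Type*} [MetricSpace X]

theorem FiniteHausdorff.exists_dist_le {f : S → X} {g : T → X} (h : FiniteHausdorff f g) :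
    ∃ R : ℝ, ∀ s, ∃ t, dist (f s) (g t) ≤ R := by
  unfold FiniteHausdorff at h
  refine ⟨(Metric.hausdorffEDist (range f) (range g) + 1).toReal, fun s => ?_⟩
  have hlt : Metric.hausdorffEDist (range f) (range g) <
      Metric.hausdorffEDist (range f) (range g) + 1 := ENNReal.lt_add_right h one_ne_zero
  obtain ⟨_, ⟨t, rfl⟩, ht⟩ := Metric.exists_edist_lt_of_hausdorffEDist_lt (mem_range_self s) hlt
  refine ⟨t, ?_⟩
  rw [dist_edist]
  exact ENNReal.toReal_mono (ENNReal.add_ne_top.2 ⟨h, ENNReal.one_ne_top⟩) ht.le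

theorem FiniteHausdorff.of_dist_le {f : S → X} {g : T → X} {R R' : ℝ}
    (h : ∀ s, ∃ t, dist (f s) (g t) ≤ R) (h' : ∀ t, ∃ s, dist (f s) (g t) ≤ R') :
    FiniteHausdorff f g := by
  refine ne_top_of_le_ne_top (ENNReal.ofReal_ne_top (r := max R R'))
    (Metric.hausdorffEDist_le_of_mem_edist ?_ ?_)
  · rintro _ ⟨s, rfl⟩
    obtain ⟨t, ht⟩ := h s
    refine ⟨g t, mem_range_self t, ?_⟩
    rw [edist_dist]
    exact ENNReal.ofReal_le_ofReal (ht.trans (le_max_left _ _))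
  · rintro _ ⟨t, rfl⟩
    obtain ⟨s, hs⟩ := h' t
    refine ⟨f s, mem_range_self s, ?_⟩
    rw [edist_dist, dist_comm]
    exact ENNReal.ofReal_le_ofReal (hs.trans (le_max_right _ _))

theorem FiniteHausdorff.symm {f : S → X} {g : T → X} (h : FiniteHausdorff f g) :
    FiniteHausdorff g f := by
  unfold FiniteHausdorff at *
  rwa [Metric.hausdorffEDist_comm]

theorem FiniteHausdorff.trans {U : Type*} {f : S → X} {g : T → X} {h : U → X}
    (h₁ : FiniteHausdorff f g) (h₂ : FiniteHausdorff g h) : FiniteHausdorff f h :=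
  ne_top_of_le_ne_top (ENNReal.add_ne_top.2 ⟨h₁, h₂⟩) Metric.hausdorffEDist_triangle

theorem RoughRay.endpoint_eq_iff {ξ ζ : RoughRay X} :
    ξ.endpoint = ζ.endpoint ↔ FiniteHausdorff ξ.toFun ζ.toFun := Quotient.eq

theorem RoughRay.represents {ξ : RoughRay X} {f : ℝ≥0 → X} (h : FiniteHausdorff ξ.toFun f) :
    Represents f ξ.endpoint :=
  fun _ hζ => (RoughRay.endpoint_eq_iff.1 hζ).trans h

theorem RoughRay.exists_abs_le (ξ : RoughRay X) : ∃ C : ℝ, 0 < C ∧ ∀ s u : ℝ≥0,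
    |(s : ℝ) - u| - C ≤ dist (ξ.toFun s) (ξ.toFun u) ∧
      dist (ξ.toFun s) (ξ.toFun u) ≤ |(s : ℝ) - u| + C := by
  obtain ⟨C, hC, h⟩ := ξ.rough
  refine ⟨C, hC, fun s u => ?_⟩
  have := h s u
  rw [NNReal.dist_eq] at this
  constructor <;> linarith [this.1, this.2]

theorem RoughRay.tendsto_dist (ξ : RoughRay X) (p : X) :
    Tendsto (fun t => dist p (ξ.toFun t)) atTop atTop := by
  obtain ⟨C, -, h⟩ := ξ.exists_abs_le
  have h1 : Tendsto (fun t : ℝ≥0 => (t : ℝ) + (-C - dist p (ξ.toFun 0))) atTop atTop :=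
    tendsto_atTop_add_const_right _ _ (NNReal.tendsto_coe_atTop.2 tendsto_id)
  refine tendsto_atTop_mono (fun t => ?_) h1
  have h2 := (h 0 t).1
  rw [NNReal.coe_zero, zero_sub, abs_neg, abs_of_nonneg (NNReal.coe_nonneg t)] at h2
  linarith [dist_triangle (ξ.toFun 0) p (ξ.toFun t), dist_comm p (ξ.toFun 0)]

/-- A continuous path that goes to infinity and does not backtrack coarsely can be reparametrized to
a rough ray. -/
theorem exists_roughRay_of_continuous {f : ℝ≥0 → X} (hf : Continuous f) {c : ℝ} (hc : 0 ≤ c)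
    (hb : ∀ r s t, r ≤ s → s ≤ t → dist (f r) (f s) + dist (f s) (f t) ≤ dist (f r) (f t) + c)
    (hlim : Tendsto (fun t => dist (f 0) (f t)) atTop atTop) :
    ∃ ξ : RoughRay X, FiniteHausdorff ξ.toFun f := by
  have hivt : ∀ s : ℝ≥0, ∃ τ : ℝ≥0, dist (f 0) (f τ) = s := by
    intro s
    obtain ⟨t, ht⟩ := (hlim.eventually_ge_atTop (s : ℝ)).exists
    have hcont : ContinuousOn (fun t => dist (f 0) (f t)) (Icc 0 t) :=
      (continuous_const.dist hf).continuousOn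
    obtain ⟨τ, -, hτ⟩ := intermediate_value_Icc (zero_le : 0 ≤ t) hcont
      (show (s : ℝ) ∈ _ from ⟨by rw [dist_self]; exact s.2, ht⟩)
    exact ⟨τ, hτ⟩
  choose τ hτ using hivt
  -- Without backtracking, the distance from `f 0` is a rough arc length parameter.
  have key : ∀ u v : ℝ≥0, u ≤ v →
      dist (f u) (f v) ≤ |dist (f 0) (f u) - dist (f 0) (f v)| + c := by
    intro u v huv
    have := hb 0 u v zero_le huv
    linarith [neg_abs_le (dist (f 0) (f u) - dist (f 0) (f v))]
  have key' : ∀ u v : ℝ≥0, dist (f u) (f v) ≤ |dist (f 0) (f u) - dist (f 0) (f v)| + c := by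
    intro u v
    rcases le_total u v with h | h
    · exact key u v h
    · rw [dist_comm, abs_sub_comm]
      exact key v u h
  refine ⟨⟨fun s => f (τ s), c + 1, by linarith, fun s u => ?_⟩, ?_⟩
  · have h1 := key' (τ s) (τ u)
    have h2 := abs_dist_sub_le (f (τ s)) (f (τ u)) (f 0)
    rw [dist_comm _ (f 0), dist_comm _ (f 0)] at h2
    rw [hτ, hτ] at h1 h2
    rw [NNReal.dist_eq]
    constructor <;> linarith
  · refine FiniteHausdorff.of_dist_le (R := 0) (R' := c) (fun s => ⟨τ s, by simp⟩) fun t => ?_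
    refine ⟨(dist (f 0) (f t)).toNNReal, ?_⟩
    have := key' (τ (dist (f 0) (f t)).toNNReal) t
    rw [hτ, Real.coe_toNNReal _ dist_nonneg, sub_self, abs_zero, zero_add] at this
    exact this

end Hausdorff

theorem tendsto_const_add_natCast_nnreal (r : ℝ≥0) :
    Tendsto (fun m : ℕ => r + (m : ℝ≥0)) atTop atTop :=
  tendsto_atTop_mono (fun _ => le_add_of_nonneg_left zero_le) tendsto_natCast_atTop_atTop

/-! ### Comparison of the two distances on the half-space -/

/-- The distance on `H⁺` and the distance of the cone are comparable, and so are the relations of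
lying roughly between two points. -/
structure ConeComparison (H : Type*) [MetricSpace H] [MetricSpace (HPlus H)] (L C : ℝ) : Prop where
  one_le : 1 ≤ L
  nonneg : 0 ≤ C
  quasi : IsQuasiEmbedding L C (HPlus.toCone : HPlus H → HypCone H)
  between_of_num : ∀ c : ℝ, 0 < c → ∃ c' : ℝ, 0 ≤ c' ∧ ∀ p q w : HPlus H,
    HypCone.num p w * HypCone.num w q ≤ c * w.height * HypCone.num p q →
      dist p w + dist w q ≤ dist p q + c'
  num_of_between : ∀ c : ℝ, ∃ K : ℝ, 1 ≤ K ∧ ∀ p q w : HPlus H,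
    dist p w + dist w q ≤ dist p q + c →
      HypCone.num p w * HypCone.num w q ≤ K * w.height * HypCone.num p q

namespace ConeComparison

open HypCone

variable {H : Type*} [MetricSpace H] [MetricSpace (HPlus H)] {L C : ℝ}

/-- The Morse lemma for the identity in both directions; the second one needs the hyperbolicity of
`H⁺`. -/
theorem of_quasiEmbedding (hL : 1 ≤ L) (hC : 0 ≤ C)
    (hq : IsQuasiEmbedding L C (HPlus.toCone : HPlus H → HypCone H))
    (hX : IsRoughlyGeodesic (HPlus H)) : ConeComparison H L C := by
  refine ⟨hL, hC, hq, fun c hc => ?_, fun c => ?_⟩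
  · obtain ⟨c', h⟩ := hq.exists_gromovProd_le hL hC hX isGromovHyperbolic (Real.log c)
    refine ⟨max 0 (2 * c'), le_max_left _ _, fun p q w hw => ?_⟩
    have := h p q w ((gromovProd_toCone_le_log_iff hc).2 hw)
    unfold gromovProd at this
    linarith [le_max_right 0 (2 * c')]
  · have hyp : IsGromovHyperbolic (HPlus H) := IsGromovHyperbolic.of_quasiEmbedding hL hC hq
      (fun p => ⟨p, rfl⟩) hX isGromovHyperbolic
    have hL0 : 0 < L := by linarith
    have hinv : IsQuasiEmbedding L (L * C) (fun p : HypCone H => (show HPlus H from p)) := by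
      intro p q
      have h := hq p q
      refine ⟨?_, (hq.dist_le hL p q).trans (by rw [mul_add]; exact le_refl _)⟩
      have h2 : dist p q ≤ L * @dist (HPlus H) _ p q + C := h.2
      rw [sub_le_iff_le_add, inv_mul_le_iff₀ hL0]
      change dist p q ≤ L * (@dist (HPlus H) _ p q + L * C)
      nlinarith [mul_nonneg (mul_nonneg (by linarith : 0 ≤ L - 1) (by linarith : 0 ≤ L + 1)) hC]
    obtain ⟨c', h⟩ := hinv.exists_gromovProd_le hL (by positivity) isRoughlyGeodesic hyp (c / 2)
    refine ⟨Real.exp (max 0 c'), Real.one_le_exp (le_max_left _ _), fun p q w hw => ?_⟩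
    rw [← gromovProd_toCone_le_log_iff (Real.exp_pos _), Real.log_exp]
    refine (h p.toCone q.toCone w.toCone ?_).trans (le_max_right _ _)
    change gromovProd p q w ≤ c / 2
    unfold gromovProd
    linarith

variable (h : ConeComparison H L C)

include h

theorem dist_le (p q : HPlus H) : dist p q ≤ L * (coneDist p q + C) := h.quasi.dist_le h.one_le p q

theorem coneDist_le (p q : HPlus H) : coneDist p q ≤ L * dist p q + C := (h.quasi p q).2

theorem dist_le_of_coneDist_le {p q : HPlus H} {R : ℝ} (hR : coneDist p q ≤ R) :
    dist p q ≤ L * (R + C) :=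
  (h.dist_le p q).trans
    (mul_le_mul_of_nonneg_left (by linarith) (by linarith [h.one_le]))

theorem coneDist_le_of_dist_le {p q : HPlus H} {R : ℝ} (hR : dist p q ≤ R) :
    coneDist p q ≤ L * R + C := by
  have := mul_le_mul_of_nonneg_left hR (show 0 ≤ L by linarith [h.one_le])
  linarith [h.coneDist_le p q]

theorem tendsto_coneDist (ξ : RoughRay (HPlus H)) (p : HPlus H) :
    Tendsto (fun t => coneDist p (ξ.toFun t)) atTop atTop := by
  have hL : 0 < L⁻¹ := inv_pos.2 (by linarith [h.one_le])
  exact tendsto_atTop_mono (fun t => (h.quasi p (ξ.toFun t)).1)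
    (tendsto_atTop_add_const_right _ (-C) ((ξ.tendsto_dist p).const_mul_atTop hL))

/-- A rough ray that converges to a vertical ray, in the sense of the cone, is close to it. -/
theorem finiteHausdorff_vert {σ : ℝ} (hσ : σ * σ = 1) (ξ : RoughRay (HPlus H)) {b : H} {κ : ℝ}
    (hκ : 0 ≤ κ) (hb : ∀ᶠ r in atTop, dist (ξ.toFun r).base b ≤ κ * (ξ.toFun r).height)
    (hlim : Tendsto (fun r => σ * Real.log (ξ.toFun r).height) atTop atTop) :
    FiniteHausdorff ξ.toFun (fun s : ℝ≥0 => vert b (σ * s)) := by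
  obtain ⟨C', hC', hξ⟩ := ξ.exists_abs_le
  have hσ1 : |σ| = 1 := by
    have : |σ| * |σ| = 1 := by rw [← abs_mul, hσ, abs_one]
    nlinarith [abs_nonneg σ]
  obtain ⟨r₀, hr₀⟩ := eventually_atTop.1 (hb.and (hlim.eventually_ge_atTop 0))
  set u : ℝ≥0 → ℝ := fun r => σ * Real.log (ξ.toFun r).height with hu
  set R₁ : ℝ := L * (2 * Real.log (κ + 1) + C) with hR₁
  have near : ∀ r, r₀ ≤ r → dist (ξ.toFun r) (vert b (σ * u r)) ≤ R₁ := by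
    intro r hr
    have hh := (ξ.toFun r).height_pos
    have e : Real.exp (σ * u r) = (ξ.toFun r).height := by
      rw [hu, ← mul_assoc, hσ, one_mul, Real.exp_log hh]
    have hn : num (ξ.toFun r) (vert b (σ * u r)) ≤ (κ + 1) * (ξ.toFun r).height := by
      simp only [num, vert, e, max_self]
      linarith [(hr₀ r hr).1]
    refine h.dist_le_of_coneDist_le (coneDist_le_of_num_le (by linarith) hn ?_)
    simpa only [vert, e] using hn
  -- A rough ray may jump, but its logarithmic height moves boundedly per unit of time, so it leaves
  -- no long gap along the vertical ray.
  have hJ : ∀ r, u (r + 1) ≤ u r + (L * (1 + C') + C) := by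
    intro r
    have e1 := (hξ (r + 1) r).2
    rw [NNReal.coe_add, NNReal.coe_one, add_sub_cancel_left, abs_one] at e1
    have e2 := (abs_log_height_sub_le _ _).trans (h.coneDist_le_of_dist_le e1)
    have e3 : |u (r + 1) - u r| ≤ L * (1 + C') + C := by
      rw [hu, ← mul_sub, abs_mul, hσ1, one_mul]
      exact e2
    linarith [le_abs_self (u (r + 1) - u r)]
  set J := L * (1 + C') + C with hJdef
  have hJ0 : 0 ≤ J := by
    have := h.one_le
    have := h.nonneg
    positivity
  have hu0 : 0 ≤ u r₀ := (hr₀ r₀ (le_refl _)).2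
  refine FiniteHausdorff.of_dist_le (R := r₀ + C' + R₁) (R' := R₁ + L * (J + u r₀ + C))
    (fun r => ?_) fun s => ?_
  · rcases le_total r₀ r with hr | hr
    · refine ⟨⟨u r, (hr₀ r hr).2⟩, (near r hr).trans ?_⟩
      linarith [r₀.2]
    · refine ⟨⟨u r₀, hu0⟩, ?_⟩
      have e1 := (hξ r r₀).2
      have e2 : (r : ℝ) ≤ r₀ := hr
      rw [abs_sub_comm, abs_of_nonneg (by linarith)] at e1
      have e3 := near r₀ (le_refl _)
      have e4 := dist_triangle (ξ.toFun r) (ξ.toFun r₀) (vert b (σ * u r₀))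
      change dist (ξ.toFun r) (vert b (σ * u r₀)) ≤ _
      linarith [r.2]
  · have hex : ∃ m : ℕ, (s : ℝ) ≤ u (r₀ + m) := by
      have : Tendsto (fun m : ℕ => u (r₀ + m)) atTop atTop :=
        hlim.comp (tendsto_const_add_natCast_nnreal _)
      exact (this.eventually_ge_atTop _).exists
    classical
    obtain ⟨m, hm1, hm2⟩ : ∃ m : ℕ, (s : ℝ) ≤ u (r₀ + m) ∧ u (r₀ + m) ≤ s + (J + u r₀) := by
      refine ⟨Nat.find hex, Nat.find_spec hex, ?_⟩
      rcases Nat.eq_zero_or_pos (Nat.find hex) with h0 | h0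
      · rw [h0, Nat.cast_zero, add_zero]
        linarith [s.2]
      · obtain ⟨j, hj⟩ : ∃ j, Nat.find hex = j + 1 := ⟨Nat.find hex - 1, by omega⟩
        have hmin := Nat.find_min hex (m := j) (by omega)
        have := hJ (r₀ + j)
        rw [hj, Nat.cast_add, Nat.cast_one, ← add_assoc]
        linarith
    refine ⟨r₀ + m, ?_⟩
    have e1 := near (r₀ + m) (le_add_of_nonneg_right zero_le)
    have e2 : dist (vert b (σ * u (r₀ + m))) (vert b (σ * s)) ≤ L * (J + u r₀ + C) := by
      refine h.dist_le_of_coneDist_le ?_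
      rw [coneDist_vert, ← mul_sub, abs_mul, hσ1, one_mul, abs_of_nonneg (by linarith)]
      linarith
    exact (dist_triangle _ _ _).trans (add_le_add e1 e2)

/-- A rough ray at bounded distance from a vertical ray converges to it in the sense of the cone. -/
theorem tendsto_of_finiteHausdorff_vert {σ : ℝ} (hσ : σ * σ = 1) {ξ : RoughRay (HPlus H)} {b : H}
    (hξ : FiniteHausdorff ξ.toFun (fun s : ℝ≥0 => vert b (σ * s))) :
    Tendsto (fun r => σ * Real.log (ξ.toFun r).height) atTop atTop ∧
      ∃ κ : ℝ, 0 ≤ κ ∧ ∀ r, dist (ξ.toFun r).base b ≤ κ * (ξ.toFun r).height := by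
  have hσ1 : |σ| = 1 := by
    have : |σ| * |σ| = 1 := by rw [← abs_mul, hσ, abs_one]
    nlinarith [abs_nonneg σ]
  obtain ⟨R, hR⟩ := hξ.exists_dist_le
  choose s hs using hR
  have hs' : ∀ r, coneDist (ξ.toFun r) (vert b (σ * s r)) ≤ L * R + C := fun r =>
    h.coneDist_le_of_dist_le (hs r)
  refine ⟨?_, Real.exp (L * R + C), (Real.exp_pos _).le, fun r => ?_⟩
  · refine tendsto_atTop_mono (fun r => ?_) (tendsto_atTop_add_const_right _ (-2 * (L * R + C))
      (h.tendsto_coneDist ξ (vert b 0)))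
    have e1 := coneDist_triangle (vert b 0) (vert b (σ * s r)) (ξ.toFun r)
    rw [coneDist_vert, zero_sub, abs_neg, abs_mul, hσ1, one_mul, abs_of_nonneg (NNReal.coe_nonneg _),
      coneDist_comm (vert b (σ * s r)) (ξ.toFun r)] at e1
    have e2 := (abs_log_height_sub_le _ _).trans (hs' r)
    simp only [vert, Real.log_exp] at e2
    have e3 : |σ * Real.log (ξ.toFun r).height - s r| ≤ L * R + C := by
      rw [show σ * Real.log (ξ.toFun r).height - s r =
        σ * (Real.log (ξ.toFun r).height - σ * s r) by
          rw [mul_sub, ← mul_assoc σ σ, hσ, one_mul], abs_mul, hσ1, one_mul]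
      exact e2
    have e4 := (abs_le.1 e3).1
    have e5 := hs' r
    change coneDist (vert b 0) (ξ.toFun r) + -2 * (L * R + C) ≤ _
    linarith
  · have e := hs' r
    rw [coneDist_comm] at e
    have := dist_base_le_num (vert b (σ * s r)) (ξ.toFun r)
    rw [dist_comm] at this
    exact this.trans (num_le_of_coneDist_le e)

/-- Every rough ray is close to a descending or an ascending vertical ray. -/
theorem exists_finiteHausdorff_vert [CompleteSpace H] (ξ : RoughRay (HPlus H)) :
    ∃ b : H, FiniteHausdorff ξ.toFun (fun s : ℝ≥0 => vert b (-1 * s)) ∨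
      FiniteHausdorff ξ.toFun (fun s : ℝ≥0 => vert b (1 * s)) := by
  obtain ⟨C', hC', hξ⟩ := ξ.exists_abs_le
  obtain ⟨K, hK, hbet⟩ := h.num_of_between (3 * C')
  set x : ℝ≥0 → HPlus H := ξ.toFun with hx
  -- Since `x r` lies roughly between `x 0` and `x u`, the product of the two values of `num` is at
  -- most `K * (x r).height` times their sum, which bounds the smaller one.
  have hb : ∀ r u, r ≤ u → num (x 0) (x r) ≤ 2 * K * (x r).height ∨
      num (x r) (x u) ≤ 2 * K * (x r).height := by
    intro r u hru
    have hru' : (r : ℝ) ≤ u := hru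
    have e1 := (hξ 0 r).2
    have e2 := (hξ r u).2
    have e3 := (hξ 0 u).1
    rw [NNReal.coe_zero, zero_sub, abs_neg, abs_of_nonneg (NNReal.coe_nonneg _)] at e1 e3
    rw [abs_sub_comm, abs_of_nonneg (by linarith)] at e2
    have key := hbet (x 0) (x u) (x r) (by linarith)
    have n1 := num_pos (x 0) (x r)
    have n2 := num_pos (x r) (x u)
    have n3 := num_triangle (x 0) (x r) (x u)
    have hr := (x r).height_pos
    have hKr : 0 < K * (x r).height := by positivity
    have key' : num (x 0) (x r) * num (x r) (x u) ≤
        K * (x r).height * (num (x 0) (x r) + num (x r) (x u)) :=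
      key.trans (mul_le_mul_of_nonneg_left n3 hKr.le)
    by_contra! hcon
    obtain ⟨c1, c2⟩ := hcon
    nlinarith
  have hlim := h.tendsto_coneDist ξ
  -- If the first alternative always holds, the height tends to infinity and the ray ascends. If it
  -- fails once, the second one bounds `num` from then on, and as the cone distance diverges, the
  -- height must tend to 0.
  by_cases hcase : ∀ r, num (x 0) (x r) ≤ 2 * K * (x r).height
  · refine ⟨(x 0).base, Or.inr (h.finiteHausdorff_vert (by norm_num) ξ (κ := 2 * K) (by linarith)
      (Eventually.of_forall fun r => ?_) ?_)⟩
    · rw [dist_comm]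
      exact (dist_base_le_num _ _).trans (hcase r)
    · refine tendsto_atTop_mono (fun r => ?_) (tendsto_atTop_add_const_right _
        (-2 * Real.log (2 * K) + Real.log (x 0).height) (hlim (x 0)))
      have e := Real.log_le_log (num_pos _ _) (hcase r)
      rw [Real.log_mul (by positivity) (x r).height_pos.ne'] at e
      have := coneDist_eq (x 0) (x r)
      change coneDist (x 0) (x r) + _ ≤ 1 * Real.log (x r).height
      linarith
  · push Not at hcase
    obtain ⟨r₀, hr₀⟩ := hcase
    have hbd : ∀ u, r₀ ≤ u → num (x r₀) (x u) ≤ 2 * K * (x r₀).height := fun u hu =>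
      (hb r₀ u hu).resolve_left (not_le.2 hr₀)
    have hneg : Tendsto (fun r => -1 * Real.log (x r).height) atTop atTop := by
      refine tendsto_atTop_mono' _ ?_ (tendsto_atTop_add_const_right _
        (-2 * Real.log (2 * K * (x r₀).height) + Real.log (x r₀).height) (hlim (x r₀)))
      filter_upwards [eventually_ge_atTop r₀] with r hr
      have e := Real.log_le_log (num_pos _ _) (hbd r hr)
      have := coneDist_eq (x r₀) (x r)
      change coneDist (x r₀) (x r) + _ ≤ _
      linarith
    have hlog : Tendsto (fun r => Real.log (x r).height) atTop atBot := by
      have := tendsto_neg_atTop_atBot.comp hneg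
      refine this.congr fun r => ?_
      simp
    have hzero : Tendsto (fun r => (x r).height) atTop (𝓝 0) := by
      refine (Real.tendsto_exp_atBot.comp hlog).congr fun r => ?_
      exact Real.exp_log (x r).height_pos
    have hzero' : Tendsto (fun r => 2 * K * (x r).height) atTop (𝓝 0) := by
      simpa using hzero.const_mul (2 * K)
    obtain ⟨r₁, hr₁⟩ := eventually_atTop.1
      (hzero'.eventually (gt_mem_nhds (x 0).height_pos))
    -- Because `num (x 0) (x r)` is at least the height of `x 0`, only the second alternative
    -- survives at small heights; it makes the base points Cauchy.
    have hcau : ∀ r, r₁ ≤ r → ∀ u, r ≤ u → dist (x r).base (x u).base ≤ 2 * K * (x r).height := by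
      intro r hr u hu
      refine (dist_base_le_num _ _).trans ((hb r u hu).resolve_left (not_le.2 ?_))
      exact (hr₁ r hr).trans_le (height_le_num_left _ _)
    have hseq : CauchySeq (fun m : ℕ => (x (r₁ + m)).base) := by
      refine cauchySeq_of_le_tendsto_0' (fun m : ℕ => 2 * K * (x (r₁ + m)).height)
        (fun m k hmk => ?_) ?_
      · refine hcau _ (le_add_of_nonneg_right zero_le) _ ?_
        have : (m : ℝ≥0) ≤ k := by exact_mod_cast hmk
        gcongr
      · exact hzero'.comp (tendsto_const_add_natCast_nnreal _)
    obtain ⟨b, hbl⟩ := cauchySeq_tendsto_of_complete hseq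
    refine ⟨b, Or.inl (h.finiteHausdorff_vert (by norm_num) ξ (κ := 2 * K) (by linarith) ?_ hneg)⟩
    filter_upwards [eventually_ge_atTop r₁] with r hr
    refine le_of_tendsto (tendsto_const_nhds.dist hbl) ?_
    obtain ⟨m₀, hm₀⟩ := exists_nat_ge r
    filter_upwards [eventually_ge_atTop m₀] with m hm
    refine hcau r hr _ ?_
    have : (m₀ : ℝ≥0) ≤ m := by exact_mod_cast hm
    exact (hm₀.trans this).trans (le_add_of_nonneg_left zero_le)

/-- Every vertical ray is close to a rough ray. -/
theorem exists_roughRay_vert {σ : ℝ} (hσ : σ * σ = 1) (b : H)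
    (hcont : Continuous (fun v : ℝ => vert b v)) :
    ∃ ξ : RoughRay (HPlus H), FiniteHausdorff ξ.toFun (fun s : ℝ≥0 => vert b (σ * s)) := by
  have hσ1 : |σ| = 1 := by
    have : |σ| * |σ| = 1 := by rw [← abs_mul, hσ, abs_one]
    nlinarith [abs_nonneg σ]
  have hL : 0 < L⁻¹ := inv_pos.2 (by linarith [h.one_le])
  obtain ⟨c, hc, hbet⟩ := h.between_of_num 1 one_pos
  have hd : ∀ u v : ℝ≥0, coneDist (vert b (σ * u)) (vert b (σ * v)) = |(u : ℝ) - v| := by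
    intro u v
    rw [coneDist_vert, ← mul_sub, abs_mul, hσ1, one_mul]
  refine exists_roughRay_of_continuous (c := c)
    (hcont.comp (continuous_const.mul NNReal.continuous_coe)) hc (fun r s t hrs hst => ?_) ?_
  · refine hbet _ _ _ ((gromovProd_toCone_le_log_iff one_pos).1 ?_)
    unfold gromovProd
    simp only [dist_toCone]
    rw [hd, hd, hd, Real.log_one]
    have h1 : (r : ℝ) ≤ s := hrs
    have h2 : (s : ℝ) ≤ t := hst
    rw [abs_of_nonpos (by linarith), abs_of_nonpos (by linarith), abs_of_nonpos (by linarith)]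
    linarith
  · refine tendsto_atTop_mono (fun t => ?_) ((tendsto_atTop_add_const_right _ (-C)
      (NNReal.tendsto_coe_atTop.2 tendsto_id)).const_mul_atTop hL)
    have e := h.coneDist_le (vert b (σ * (0 : ℝ≥0))) (vert b (σ * t))
    rw [hd, NNReal.coe_zero, zero_sub, abs_neg, abs_of_nonneg (NNReal.coe_nonneg t)] at e
    rw [inv_mul_le_iff₀ (by linarith [h.one_le])]
    simp only [id, NNReal.coe_zero]
    linarith

/-- At heights `e ^ s ≥ 1` a fixed horizontal displacement has bounded cone length. -/
theorem finiteHausdorff_upRay (x y : H) :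
    FiniteHausdorff (HPlus.upRay x) (HPlus.upRay y) := by
  have key : ∀ s : ℝ≥0, dist (HPlus.upRay x s) (HPlus.upRay y s) ≤
      L * (2 * Real.log (dist x y + 1) + C) := by
    intro s
    have : num (HPlus.upRay x s) (HPlus.upRay y s) ≤ (dist x y + 1) * Real.exp s := by
      simp only [num, HPlus.upRay, max_self]
      nlinarith [dist_nonneg (x := x) (y := y), Real.one_le_exp (NNReal.coe_nonneg s)]
    exact h.dist_le_of_coneDist_le
      (coneDist_le_of_num_le (by linarith [dist_nonneg (x := x) (y := y)]) this this)
  exact FiniteHausdorff.of_dist_le (fun s => ⟨s, key s⟩) fun s => ⟨s, key s⟩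

end ConeComparison

namespace HypCone

variable {H : Type*}

theorem downRay_eq_vert (x : H) : HPlus.downRay x = fun s : ℝ≥0 => vert x (-1 * s) := by
  funext s
  simp [HPlus.downRay, vert]

theorem upRay_eq_vert (x : H) : HPlus.upRay x = fun s : ℝ≥0 => vert x (1 * s) := by
  funext s
  simp [HPlus.upRay, vert]

end HypCone

/-! ### The boundary of the half-space. -/

namespace ConeComparison

open HypCone

variable {H : Type*} [MetricSpace H] [MetricSpace (HPlus H)] {L C : ℝ} (h : ConeComparison H L C)

include h

/-- A rough ray close to a descending vertical ray converges to its foot. -/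
theorem tendsto_of_downRay {ξ : RoughRay (HPlus H)} {b : H}
    (hξ : FiniteHausdorff ξ.toFun (HPlus.downRay b)) :
    Tendsto (fun r => (ξ.toFun r).height) atTop (𝓝 0) ∧
      Tendsto (fun r => (ξ.toFun r).base) atTop (𝓝 b) := by
  rw [downRay_eq_vert] at hξ
  obtain ⟨h1, κ, hκ, h2⟩ := h.tendsto_of_finiteHausdorff_vert (by norm_num) hξ
  have hlog : Tendsto (fun r => Real.log (ξ.toFun r).height) atTop atBot := by
    refine (tendsto_neg_atTop_atBot.comp h1).congr fun r => ?_
    simp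
  have hzero : Tendsto (fun r => (ξ.toFun r).height) atTop (𝓝 0) :=
    (Real.tendsto_exp_atBot.comp hlog).congr fun r => Real.exp_log (ξ.toFun r).height_pos
  refine ⟨hzero, tendsto_iff_dist_tendsto_zero.2 (squeeze_zero (fun _ => dist_nonneg) h2 ?_)⟩
  simpa using hzero.const_mul κ

/-- The height of a rough ray close to an ascending vertical ray tends to infinity. -/
theorem tendsto_of_upRay {ξ : RoughRay (HPlus H)} {b : H}
    (hξ : FiniteHausdorff ξ.toFun (HPlus.upRay b)) :
    Tendsto (fun r => (ξ.toFun r).height) atTop atTop := by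
  rw [upRay_eq_vert] at hξ
  obtain ⟨h1, -⟩ := h.tendsto_of_finiteHausdorff_vert (by norm_num) hξ
  refine (Real.tendsto_exp_atTop.comp h1).congr fun r => ?_
  simp [Real.exp_log (ξ.toFun r).height_pos]

/-- The boundary of `H⁺` is the one-point extension of `H`. -/
theorem exists_endpointMap [CompleteSpace H] [Nonempty H]
    (hcont : ∀ b : H, Continuous (fun v : ℝ => vert b v)) :
    ∃ ι : OnePoint H → BoundaryAtInfinity (HPlus H), IsEndpointMap ι ∧ Function.Bijective ι := by
  have hdown : ∀ b : H, ∃ ξ : RoughRay (HPlus H), FiniteHausdorff ξ.toFun (HPlus.downRay b) := by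
    intro b
    rw [downRay_eq_vert]
    exact h.exists_roughRay_vert (by norm_num) b (hcont b)
  have hup : ∀ b : H, ∃ ξ : RoughRay (HPlus H), FiniteHausdorff ξ.toFun (HPlus.upRay b) := by
    intro b
    rw [upRay_eq_vert]
    exact h.exists_roughRay_vert (by norm_num) b (hcont b)
  choose ξ hξ using hdown
  obtain ⟨x₀⟩ := ‹Nonempty H›
  obtain ⟨η, hη⟩ := hup x₀
  have hne : ∀ x, η.endpoint ≠ (ξ x).endpoint := by
    intro x hx
    have e1 := (h.tendsto_of_downRay ((RoughRay.endpoint_eq_iff.1 hx).trans (hξ x))).1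
    exact not_tendsto_nhds_of_tendsto_atTop (h.tendsto_of_upRay hη) 0 e1
  refine ⟨fun o => o.elim η.endpoint fun x => (ξ x).endpoint, ⟨fun x => ?_, fun x => ?_⟩, ?_, ?_⟩
  · exact RoughRay.represents (hξ x)
  · exact RoughRay.represents (hη.trans (h.finiteHausdorff_upRay x₀ x))
  · intro o o'
    induction o using OnePoint.rec with
    | infty =>
      induction o' using OnePoint.rec with
      | infty => exact fun _ => rfl
      | coe y => exact fun e => absurd e (hne y)
    | coe x =>
      induction o' using OnePoint.rec with
      | infty => exact fun e => absurd e.symm (hne x)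
      | coe y =>
        intro e
        have e1 := (h.tendsto_of_downRay (hξ x)).2
        have e2 := (h.tendsto_of_downRay ((RoughRay.endpoint_eq_iff.1 e).trans (hξ y))).2
        rw [tendsto_nhds_unique e1 e2]
  · intro z
    induction z using Quotient.inductionOn with
    | h ζ =>
      obtain ⟨b, hb | hb⟩ := h.exists_finiteHausdorff_vert ζ
      · rw [← downRay_eq_vert] at hb
        exact ⟨(b : OnePoint H), RoughRay.endpoint_eq_iff.2 ((hξ b).trans hb.symm)⟩
      · rw [← upRay_eq_vert] at hb
        exact ⟨OnePoint.infty, RoughRay.endpoint_eq_iff.2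
          ((hη.trans (h.finiteHausdorff_upRay x₀ b)).trans hb.symm)⟩

end ConeComparison

/-- A quasi-additive function on the integers is at bounded distance from a linear one. -/
theorem exists_linear_of_quasiAdditive {ψ : ℤ → ℝ} {B : ℝ}
    (h : ∀ m k, |ψ (m + k) - ψ m - ψ k| ≤ B) : ∃ κ : ℝ, ∀ k : ℤ, |ψ k - k * κ| ≤ 3 * B := by
  have hmul : ∀ (m : ℕ) (k : ℤ), |ψ ((m + 1 : ℕ) * k) - (m + 1 : ℕ) * ψ k| ≤ m * B := by
    intro m k
    induction m with
    | zero => simp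
    | succ m ih =>
      have e1 := h ((m + 1 : ℕ) * k) k
      rw [show ((m + 1 : ℕ) : ℤ) * k + k = ((m + 1 + 1 : ℕ) : ℤ) * k by push_cast; ring] at e1
      rw [abs_le] at *
      push_cast at *
      constructor <;> linarith [e1.1, e1.2, ih.1, ih.2]
  -- Comparing both with `ψ ((m + 1) * (n + 1))`, every lower slope is at most every upper slope;
  -- the supremum of the lower ones serves as `κ`.
  have hcmp : ∀ m n : ℕ, (ψ (n + 1 : ℕ) - B) / (n + 1 : ℕ) ≤ (ψ (m + 1 : ℕ) + B) / (m + 1 : ℕ) := by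
    intro m n
    rw [div_le_div_iff₀ (by positivity) (by positivity)]
    have e1 := (abs_le.1 (hmul m (n + 1 : ℕ))).1
    have e2 := (abs_le.1 (hmul n (m + 1 : ℕ))).2
    rw [mul_comm ((m + 1 : ℕ) : ℤ)] at e1
    push_cast at *
    linarith [(abs_nonneg _).trans (h 0 0)]
  have hbdd : BddAbove (range fun n : ℕ => (ψ (n + 1 : ℕ) - B) / (n + 1 : ℕ)) :=
    ⟨_, by rintro _ ⟨n, rfl⟩; exact hcmp 0 n⟩
  have h0 := h 0 0
  have hB : 0 ≤ B := (abs_nonneg _).trans h0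
  obtain ⟨κ, hκ⟩ : ∃ κ : ℝ, ∀ n : ℕ, |ψ n - n * κ| ≤ B := by
    refine ⟨⨆ n : ℕ, (ψ (n + 1 : ℕ) - B) / (n + 1 : ℕ), fun n => ?_⟩
    rcases n with _ | n
    · rw [add_zero, sub_self, zero_sub, abs_neg] at h0
      simpa using h0
    · have hn : (0 : ℝ) < (n + 1 : ℕ) := by positivity
      have e1 := le_ciSup hbdd n
      have e2 := ciSup_le fun k => hcmp n k
      rw [div_le_iff₀ hn] at e1
      rw [le_div_iff₀ hn] at e2
      rw [abs_le]
      constructor <;> linarith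
  refine ⟨κ, fun k => ?_⟩
  obtain ⟨n, rfl | rfl⟩ := k.eq_nat_or_neg
  · exact_mod_cast (hκ n).trans (by linarith)
  -- One `B` each for additivity at `n` and `-n`, for `ψ 0`, and for the estimate at `n`.
  · have e1 := h n (-n)
    have e2 := hκ n
    rw [add_neg_cancel] at e1
    rw [add_zero, sub_self, zero_sub, abs_neg] at h0
    rw [abs_le] at *
    push_cast
    constructor <;> linarith [e1.1, e1.2, e2.1, e2.2, h0.1, h0.2]

/-- Linear growth beats the logarithm; this excludes drift along powers of an isometry. At `n = m ^
2` the logarithm is at most linear in `m`. -/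
theorem nonpos_of_mul_le_log {e L D C : ℝ} (hL : 0 ≤ L) (hD : 0 ≤ D) (hC : 0 ≤ C)
    (h : ∀ n : ℕ, n * e ≤ L * (2 * Real.log (n * D + 1) + C)) : e ≤ 0 := by
  by_contra! he
  obtain ⟨m, hm⟩ := exists_nat_gt (L * (4 * (D + 1) + C) / e)
  rw [div_lt_iff₀ he] at hm
  have hm0 : 0 < m := by
    rcases Nat.eq_zero_or_pos m with rfl | h0
    · have : 0 ≤ L * (4 * (D + 1) + C) := by positivity
      simp at hm
      linarith
    · exact h0
  have hm1 : (1 : ℝ) ≤ m := by exact_mod_cast hm0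
  have hlog : Real.log ((m ^ 2 : ℕ) * D + 1) ≤ 2 * (m * (D + 1)) := by
    have e1 : ((m ^ 2 : ℕ) : ℝ) * D + 1 ≤ (m * (D + 1)) ^ 2 := by
      push_cast
      nlinarith [mul_nonneg (sq_nonneg (m : ℝ)) hD, mul_nonneg (sq_nonneg (m : ℝ)) (sq_nonneg D)]
    have e2 := Real.log_le_log (by positivity) e1
    rw [Real.log_pow] at e2
    have e3 := Real.log_le_sub_one_of_pos (show 0 < m * (D + 1) by positivity)
    push_cast at e2 ⊢
    linarith
  have e1 := h (m ^ 2)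
  have e2 : L * (2 * Real.log ((m ^ 2 : ℕ) * D + 1) + C) ≤ L * (m * (4 * (D + 1) + C)) := by
    refine mul_le_mul_of_nonneg_left ?_ hL
    nlinarith
  push_cast at e1 e2
  nlinarith

/-! ### Busemann functions and Gromov products at infinity. -/

namespace ConeComparison

open HypCone

variable {H : Type*} [MetricSpace H] [MetricSpace (HPlus H)] {L C : ℝ} (h : ConeComparison H L C)

include h

/-- The Busemann function of the point at infinity, up to a bounded error. -/
theorem exists_busemann (o : HPlus H) : ∃ (A : ℝ) (b : HPlus H → ℝ), 0 ≤ A ∧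
    (∀ w, |b w| ≤ dist o w) ∧
    ∀ w, ∃ N : ℝ, ∀ q : HPlus H, N ≤ q.height → |dist o q - dist w q - b w| ≤ A := by
  obtain ⟨c, hc, hbet⟩ := h.between_of_num 4 (by norm_num)
  -- This point above `o` lies roughly between `q` and each of `o`, `w` once `q` is high, so `dist o
  -- q - dist w q` is nearly `dist o (v w) - dist w (v w)`.
  let v : HPlus H → HPlus H := fun w => ⟨o.base, num o w, num_pos o w⟩
  refine ⟨c, fun w => dist o (v w) - dist w (v w), hc, fun w => ?_, fun w => ?_⟩
  · exact abs_dist_sub_le o w (v w)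
  refine ⟨2 * num o w, fun q hq => ?_⟩
  have ho := height_le_num_left o w
  have hw := height_le_num_right o w
  have hpos := num_pos o w
  have n1 : num o (v w) ≤ num o w := by
    simp only [num, v, dist_self, zero_add] at *
    exact max_le ho le_rfl
  have n2 : num w (v w) ≤ 2 * num o w := by
    have := dist_base_le_num o w
    have hm : max w.height (num o w) ≤ num o w := max_le hw le_rfl
    have : num w (v w) = dist w.base o.base + max w.height (num o w) := rfl
    rw [dist_comm] at this
    linarith
  have n3 : num (v w) q ≤ 2 * num w q := by
    have := num_triangle (v w) w q
    rw [num_comm (v w) w] at this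
    linarith [height_le_num_right w q]
  have n4 : num (v w) q ≤ 2 * num o q := by
    have := num_triangle (v w) o q
    rw [num_comm (v w) o] at this
    linarith [height_le_num_right o q]
  have b1 := hbet w q (v w) (by
    change _ ≤ 4 * num o w * _
    nlinarith [mul_le_mul n2 n3 (num_pos _ _).le (by linarith)])
  have b2 := hbet o q (v w) (by
    change _ ≤ 4 * num o w * _
    nlinarith [mul_le_mul n1 n4 (num_pos _ _).le (by linarith), mul_pos hpos (num_pos o q)])
  have t1 := dist_triangle w (v w) q
  have t2 := dist_triangle o (v w) q
  rw [abs_le]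
  constructor <;> linarith

/-- The limiting values of the Gromov products that define the parabolic visual quasimetric are
those of the logarithm of the distance of `H`. -/
theorem exists_gromovProd_bounds {o : HPlus H} {κ A : ℝ}
    (hbus : ∀ w : HPlus H, ∃ N : ℝ, ∀ q : HPlus H, N ≤ q.height →
      |dist o q - dist w q - κ * Real.log w.height| ≤ A)
    {η : RoughRay (HPlus H)} {z : H} (hη : FiniteHausdorff η.toFun (HPlus.upRay z)) :
    ∃ A' : ℝ, 0 ≤ A' ∧ ∀ (ξ ζ : RoughRay (HPlus H)) (x y : H),
      FiniteHausdorff ξ.toFun (HPlus.downRay x) → FiniteHausdorff ζ.toFun (HPlus.downRay y) →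
      (x ≠ y → ∀ᶠ t : ℝ≥0 in atTop, κ * Real.log (dist x y) - A' ≤
        t - gromovProd (ξ.toFun t) (ζ.toFun t) (η.toFun t)) ∧
      ∀ r : ℝ, 0 < r → dist x y ≤ r → ∀ᶠ t : ℝ≥0 in atTop,
        t - gromovProd (ξ.toFun t) (ζ.toFun t) (η.toFun t) ≤ κ * Real.log r + A' := by
  obtain ⟨c₁, hc₁, hbet₁⟩ := h.between_of_num 6 (by norm_num)
  obtain ⟨c₂, hc₂, hbet₂⟩ := h.between_of_num 12 (by norm_num)
  obtain ⟨C', hC', hrough⟩ := η.exists_abs_le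
  have hA : 0 ≤ A := by
    obtain ⟨N, hN⟩ := hbus o
    exact (abs_nonneg _).trans (hN ⟨o.base, max N 1, lt_max_of_lt_right one_pos⟩ (le_max_left _ _))
  have hto : ∀ t : ℝ≥0, |dist o (η.toFun t) - t| ≤ C' + dist o (η.toFun 0) := by
    intro t
    have e := hrough 0 t
    rw [NNReal.coe_zero, zero_sub, abs_neg, abs_of_nonneg (NNReal.coe_nonneg t)] at e
    rw [abs_le]
    constructor <;> linarith [e.1, e.2, dist_triangle o (η.toFun 0) (η.toFun t),
      dist_triangle (η.toFun 0) o (η.toFun t), dist_comm o (η.toFun 0)]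
  set A₁ := C' + dist o (η.toFun 0) with hA₁
  have hA₁0 : 0 ≤ A₁ := (abs_nonneg _).trans (hto 0)
  have hηlim := h.tendsto_of_upRay hη
  refine ⟨A + A₁ + c₁ + c₂, by positivity, fun ξ ζ x y hξ hζ => ⟨fun hxy => ?_, fun r hr hxyr => ?_⟩⟩
  · have hr : 0 < dist x y := dist_pos.2 hxy
    set r := dist x y with hrdef
    -- The top of the geodesic from `x` to `y`: since `w` is roughly between `p` and `q`, their
    -- Gromov product at `z` is at most about `dist w z`.
    set w : HPlus H := ⟨x, r, hr⟩ with hw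
    obtain ⟨N, hN⟩ := hbus w
    obtain ⟨p1, p2⟩ := h.tendsto_of_downRay hξ
    obtain ⟨q1, q2⟩ := h.tendsto_of_downRay hζ
    have hr4 : 0 < r / 4 := by positivity
    filter_upwards [hηlim.eventually_ge_atTop N, p1.eventually (gt_mem_nhds hr4),
      q1.eventually (gt_mem_nhds hr4), p2.eventually (Metric.ball_mem_nhds x hr4),
      q2.eventually (Metric.ball_mem_nhds y hr4)] with t k1 k2 k3 k4 k5
    have k6 := hN _ k1
    have k7 := hto t
    generalize ξ.toFun t = p at *
    generalize ζ.toFun t = q at *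
    generalize η.toFun t = z at *
    have k4' : dist p.base x < r / 4 := k4
    have k5' : dist q.base y < r / 4 := k5
    have n1 : num p w ≤ 2 * r := by
      have : max p.height r ≤ r := max_le (by linarith) le_rfl
      simp only [num, hw]
      linarith
    have n2 : num w q ≤ 3 * r := by
      have : max r q.height ≤ r := max_le le_rfl (by linarith)
      simp only [num, hw]
      linarith [dist_triangle x y q.base, dist_comm q.base y]
    have n3 : r ≤ 2 * num p q := by
      linarith [dist_triangle4 x p.base q.base y, dist_base_le_num p q, dist_comm p.base x]
    have hb := hbet₂ p q w (by
      change _ ≤ 12 * r * _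
      nlinarith [mul_le_mul n1 n2 (num_pos _ _).le (by linarith)])
    rw [abs_le] at k6 k7
    have k6' := k6.1
    have k7' := k7.2
    change -A ≤ dist o z - dist w z - κ * Real.log r at k6'
    unfold gromovProd
    linarith [dist_triangle p w z, dist_triangle z w q, dist_comm w z]
  -- Now `w` is roughly between `z` and each of `p`, `q`, so the product is at least about `dist w
  -- z`. Only `dist x y ≤ r` enters, which covers `x = y` with arbitrarily small `r`.
  · set w : HPlus H := ⟨x, r, hr⟩ with hw
    obtain ⟨N, hN⟩ := hbus w
    obtain ⟨p1, p2⟩ := h.tendsto_of_downRay hξ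
    obtain ⟨q1, q2⟩ := h.tendsto_of_downRay hζ
    filter_upwards [hηlim.eventually_ge_atTop N, p1.eventually (gt_mem_nhds hr),
      q1.eventually (gt_mem_nhds hr), p2.eventually (Metric.ball_mem_nhds x hr),
      q2.eventually (Metric.ball_mem_nhds y hr), hηlim.eventually_ge_atTop (3 * r)]
      with t k1 k2 k3 k4 k5 k8
    have k6 := hN _ k1
    have k7 := hto t
    generalize ξ.toFun t = p at *
    generalize ζ.toFun t = q at *
    generalize η.toFun t = z at *
    have k4' : dist p.base x < r := k4
    have k5' : dist q.base y < r := k5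
    have n1 : num p w ≤ 2 * r := by
      have : max p.height r ≤ r := max_le (by linarith) le_rfl
      simp only [num, hw]
      linarith
    have n2 : num q w ≤ 3 * r := by
      have : max q.height r ≤ r := max_le (by linarith) le_rfl
      simp only [num, hw]
      linarith [dist_triangle q.base y x, dist_comm x y]
    have n3 : num w z ≤ 2 * num p z := by
      linarith [num_triangle w p z, num_comm w p, height_le_num_right p z]
    have n4 : num w z ≤ 2 * num q z := by
      linarith [num_triangle w q z, num_comm w q, height_le_num_right q z]
    have b1 := hbet₁ p z w (by
      change _ ≤ 6 * r * _
      nlinarith [mul_le_mul n1 n3 (num_pos _ _).le (by linarith), mul_pos hr (num_pos p z)])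
    have b2 := hbet₁ q z w (by
      change _ ≤ 6 * r * _
      nlinarith [mul_le_mul n2 n4 (num_pos _ _).le (by linarith)])
    rw [abs_le] at k6 k7
    have k6' := k6.2
    have k7' := k7.1
    change dist o z - dist w z - κ * Real.log r ≤ A at k6'
    unfold gromovProd
    linarith [dist_triangle p w q, dist_comm z q, dist_comm w q]

end ConeComparison

/-! ### The Busemann function and the parabolic visual metric. -/

namespace IsMetricSimilaritySpace

open HypCone

variable {n : ℕ} {H : Type*} [MetricSpace H] [MetricSpace (HPlus H)] {T : StackedTiling n H}
  {L C : ℝ}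

/-- The Busemann function of the point at infinity is a multiple of the logarithm of the height. -/
theorem exists_busemann_height (hT : IsMetricSimilaritySpace T) (h : ConeComparison H L C) :
    ∃ (o : HPlus H) (κ A : ℝ), 0 < κ ∧ ∀ w : HPlus H, ∃ N : ℝ, ∀ q : HPlus H, N ≤ q.height →
      |dist o q - dist w q - κ * Real.log w.height| ≤ A := by
  obtain ⟨x, hx⟩ := T.exists_fixedPoint
  have ha := T.a_pos
  have hloga := Real.log_pos T.one_lt_a
  set o : HPlus H := ⟨x, 1, one_pos⟩ with ho
  obtain ⟨A, b, hA, hb, hbus⟩ := h.exists_busemann o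
  -- the Busemann function is quasi-equivariant
  have hequi : ∀ (g : HPlus H → HPlus H) (c : ℝ), IsSymmetry g c → ∀ w,
      |b (g w) - b w - b (g o)| ≤ 3 * A := by
    intro g c hg w
    obtain ⟨N₁, h₁⟩ := hbus (g w)
    obtain ⟨N₂, h₂⟩ := hbus (g o)
    obtain ⟨N₃, h₃⟩ := hbus w
    -- With `q` and `g q` beyond all thresholds, the distance differences approximating `b (g w)`,
    -- `b w` and `b (g o)` cancel, each with error `A`.
    let q : HPlus H := ⟨x, max 1 (max N₃ (max (N₁ / c) (N₂ / c))), lt_max_of_lt_left one_pos⟩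
    have hq : ∀ N, N / c ≤ q.height → N ≤ (g q).height := by
      intro N hN
      rw [hg.height, ← div_le_iff₀' hg.pos]
      exact hN
    have e1 := h₁ (g q) (hq _ (by simp [q]))
    have e2 := h₂ (g q) (hq _ (by simp [q]))
    have e3 := h₃ q (by simp [q])
    rw [hg.dist_eq] at e1 e2
    rw [abs_le] at *
    constructor <;> linarith [e1.1, e1.2, e2.1, e2.2, e3.1, e3.2]
  have hbo : b o = 0 := by
    have := hb o
    rw [dist_self] at this
    exact abs_nonpos_iff.1 this
  -- the group `Γ` preserves it
  have hΓ : ∀ γ ∈ T.Γ, |b (o.map γ 1 one_pos)| ≤ 3 * A := by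
    intro γ hγ
    set w : ℕ → HPlus H := fun m => o.map (γ ^ m : H ≃ᵢ H) 1 one_pos with hw
    have hstep : ∀ m, w (m + 1) = (w m).map γ 1 one_pos := by
      intro m
      ext
      · simp only [hw, HPlus.map, pow_succ', IsometryEquiv.mul_apply]
      · simp only [hw, HPlus.map, one_mul]
    have hw1 : w 1 = o.map γ 1 one_pos := by simp only [hw, pow_one]
    have hw0 : w 0 = o := by
      ext
      · simp [hw, HPlus.map]
      · simp [hw, HPlus.map]
    have hlin : ∀ m : ℕ, |b (w m) - m * b (w 1)| ≤ m * (3 * A) := by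
      intro m
      induction m with
      | zero => simp [hw0, hbo]
      | succ m ih =>
        have := hequi _ 1 (hT.isSymmetry_Γ hγ) (w m)
        rw [← hstep, ← hw1] at this
        rw [abs_le] at *
        push_cast
        constructor <;> linarith [ih.1, ih.2, this.1, this.2]
    have hdist : ∀ m : ℕ, dist x (w m).base ≤ m * dist x (γ x) := by
      intro m
      induction m with
      | zero => simp [hw0, ho]
      | succ m ih =>
        have e1 : (w (m + 1)).base = γ (w m).base := by rw [hstep]; rfl
        have e2 := dist_triangle x (γ x) (γ (w m).base)
        rw [γ.dist_eq] at e2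
        rw [e1]
        push_cast
        linarith
    have hcone : ∀ m : ℕ, coneDist o (w m) ≤ 2 * Real.log (m * dist x (γ x) + 1) := by
      intro m
      have hn : num o (w m) ≤ m * dist x (γ x) + 1 := by
        have := hdist m
        simp only [num, ho, hw, HPlus.map, mul_one, max_self] at this ⊢
        linarith
      have hh : (w m).height = 1 := by simp [hw, HPlus.map, ho]
      have := Real.log_le_log (num_pos _ _) hn
      rw [coneDist_eq, hh, Real.log_one]
      linarith
    -- Up to error, `b` grows with slope `|b (w 1)| - 3 * A` along the orbit, yet it is bounded by
    -- the distance from `o`, which is logarithmic in `m`.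
    have := nonpos_of_mul_le_log (e := |b (w 1)| - 3 * A) (show 0 ≤ L by linarith [h.one_le])
      (dist_nonneg (x := x) (y := γ x)) h.nonneg fun m => by
        have e1 := hlin m
        have e2 := (hb (w m)).trans (h.dist_le_of_coneDist_le (hcone m))
        have e3 : |m * b (w 1)| ≤ |b (w m)| + |b (w m) - m * b (w 1)| := by
          have := abs_sub (b (w m)) (b (w m) - m * b (w 1))
          rwa [sub_sub_cancel] at this
        rw [abs_mul, Nat.abs_cast] at e3
        linarith
    rw [← hw1]
    linarith
  -- along the axis of `α` it is quasi-linear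
  set u : ℤ → HPlus H := fun k => o.map (T.αpow k) (T.a ^ k) (zpow_pos ha k) with hu
  have hu_add : ∀ m k, u (m + k) = (u k).map (T.αpow m) (T.a ^ m) (zpow_pos ha m) := by
    intro m k
    ext
    · simp only [hu, HPlus.map, T.αpow_add]
    · simp only [hu, HPlus.map, zpow_add₀ ha.ne', mul_assoc]
  obtain ⟨κ₀, hκ₀⟩ := exists_linear_of_quasiAdditive (ψ := fun k => b (u k)) (B := 3 * A)
    fun m k => by
      have := hequi _ _ (hT.isSymmetry_α m) (u k)
      rw [← hu_add] at this
      rw [sub_right_comm]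
      exact this
  have hu_eq : ∀ k : ℕ, u k = vert x (k * Real.log T.a) := by
    intro k
    ext
    · simp only [hu, HPlus.map, vert, ho, T.αpow_fixed hx]
    · simp only [hu, HPlus.map, vert, ho, mul_one]
      rw [← Real.log_pow, Real.exp_log (pow_pos ha k), zpow_natCast]
  have ho_eq : o = vert x 0 := by
    ext
    · rfl
    · simp [ho, vert]
  obtain ⟨c, hc, hbet⟩ := h.between_of_num 4 (by norm_num)
  -- The point `u k` lies roughly between `o` and high points above it, so `b (u k)` is at least
  -- `dist o (u k)` up to a constant. This will force a positive slope.
  have hlow : ∀ k : ℕ, L⁻¹ * (k * Real.log T.a) - C - c - A ≤ b (u k) := by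
    intro k
    obtain ⟨N, hN⟩ := hbus (u k)
    let q : HPlus H := ⟨x, max (2 * (u k).height) N,
      lt_max_of_lt_left (mul_pos two_pos (u k).height_pos)⟩
    have e1 := (abs_le.1 (hN q (le_max_right _ _))).2
    have hk0 : 0 ≤ k * Real.log T.a := by positivity
    have hone : 1 ≤ (u k).height := by
      rw [hu_eq]
      exact Real.one_le_exp hk0
    have n1 : num o (u k) = (u k).height := by
      rw [hu_eq] at hone ⊢
      simp only [num, ho, vert, dist_self, zero_add] at hone ⊢
      exact max_eq_right hone
    have n2 : num (u k) q ≤ 2 * num o q := by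
      have := num_triangle (u k) o q
      rw [num_comm (u k) o, n1] at this
      linarith [height_le_num_right o q, le_max_left (2 * (u k).height) N, num_pos o q,
        (u k).height_pos, show q.height = max (2 * (u k).height) N from rfl]
    have e2 := hbet o q (u k) (by
      rw [n1]
      nlinarith [(u k).height_pos, num_pos o q,
        mul_le_mul_of_nonneg_left n2 (u k).height_pos.le,
        mul_pos (u k).height_pos (num_pos o q)])
    have e4 : k * Real.log T.a ≤ L * dist o (u k) + C := by
      have := h.coneDist_le o (u k)
      rw [hu_eq, ho_eq, coneDist_vert, zero_sub, abs_neg, abs_of_nonneg hk0] at this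
      rw [hu_eq, ho_eq]
      exact this
    have hL := h.one_le
    have e5 : L⁻¹ * (k * Real.log T.a) ≤ dist o (u k) + C := by
      rw [inv_mul_le_iff₀ (by linarith)]
      nlinarith [mul_nonneg (sub_nonneg.2 hL) h.nonneg]
    linarith
  have hκ₀pos : 0 < κ₀ := by
    have hL : 0 < L⁻¹ := inv_pos.2 (by linarith [h.one_le])
    by_contra! hneg
    obtain ⟨k, hk⟩ := exists_nat_gt ((C + c + A + 3 * (3 * A)) / (L⁻¹ * Real.log T.a))
    rw [div_lt_iff₀ (by positivity)] at hk
    have e1 := hlow k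
    have e2 := (abs_le.1 (hκ₀ k)).2
    have e3 : (k : ℝ) * κ₀ ≤ 0 := mul_nonpos_of_nonneg_of_nonpos (Nat.cast_nonneg k) hneg
    push_cast at e2
    nlinarith
  -- reduce to the core
  have hcore := hT.isCompact_box T.K_compact one_pos (r₂ := T.a)
  obtain ⟨B, hB⟩ := hcore.isBounded.subset_closedBall o
  refine ⟨o, κ₀ / Real.log T.a, A + (B + 6 * (3 * A) + κ₀), by positivity, fun w => ?_⟩
  have hbw : |b w - κ₀ / Real.log T.a * Real.log w.height| ≤ B + 6 * (3 * A) + κ₀ := by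
    obtain ⟨k, γ, hγ, hK, hh⟩ := exists_map_mem_core T w
    set w₁ := w.map (T.αpow k) (T.a ^ k) (zpow_pos ha k) with hw₁
    set w₂ := w₁.map γ 1 one_pos with hw₂
    have hmem : w₂ ∈ Metric.closedBall o B := hB ⟨hK, by simpa [hw₁, hw₂, HPlus.map] using hh⟩
    rw [Metric.mem_closedBall, dist_comm] at hmem
    have e1 := (hb w₂).trans hmem
    have e2 := hequi _ _ (hT.isSymmetry_Γ hγ) w₁
    have e3 := hΓ γ hγ
    have e4 := hequi _ _ (hT.isSymmetry_α k) w
    have e5 := hκ₀ k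
    have hlog := Real.log_le_log one_pos hh.1
    have hlog' := Real.log_le_log (one_pos.trans_le hh.1) hh.2
    rw [Real.log_mul (zpow_pos ha k).ne' w.height_pos.ne', Real.log_zpow, Real.log_one] at hlog
    rw [Real.log_mul (zpow_pos ha k).ne' w.height_pos.ne', Real.log_zpow] at hlog'
    -- Moving `w` into the core places `k * log a + log (height)` in `[0, log a]`.
    have e6 : |κ₀ / Real.log T.a * Real.log w.height + k * κ₀| ≤ κ₀ := by
      have : κ₀ / Real.log T.a * Real.log w.height + k * κ₀ =
          κ₀ / Real.log T.a * (k * Real.log T.a + Real.log w.height) := by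
        field_simp
        ring
      rw [this, abs_of_nonneg (by positivity), div_mul_eq_mul_div, div_le_iff₀ hloga]
      exact mul_le_mul_of_nonneg_left hlog' hκ₀pos.le
    rw [abs_le] at *
    constructor <;>
      linarith [e1.1, e1.2, e2.1, e2.2, e3.1, e3.2, e4.1, e4.2, e5.1, e5.2, e6.1, e6.2]
  obtain ⟨N, hN⟩ := hbus w
  refine ⟨N, fun q hq => ?_⟩
  have e1 := hN q hq
  rw [abs_le] at *
  constructor <;> linarith [e1.1, e1.2, hbw.1, hbw.2]

/-- The metric of `H`, transported to the boundary, is a parabolic visual metric. -/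
theorem isParabolicVisualMetric (hT : IsMetricSimilaritySpace T) (h : ConeComparison H L C)
    {ι : OnePoint H → BoundaryAtInfinity (HPlus H)} (hι : IsEndpointMap ι)
    (e : H ≃ PuncturedBoundary (ι OnePoint.infty))
    (he : ∀ x : H, (e x : BoundaryAtInfinity (HPlus H)) = ι (x : OnePoint H)) :
    IsParabolicVisualMetric (ι OnePoint.infty)
      (MetricSpace.induced e.symm e.symm.injective inferInstance) := by
  obtain ⟨o, κ, A, hκ, hbus⟩ := hT.exists_busemann_height h
  -- This base turns exponents close to `κ * log d` into quantities comparable to `d`.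
  refine ⟨Real.exp κ⁻¹, Real.one_lt_exp_iff.2 (inv_pos.2 hκ), fun η hη => ?_⟩
  obtain ⟨A', hA', hbd⟩ := h.exists_gromovProd_bounds hbus (hι.2 o.base η hη)
  refine ⟨Real.exp (κ⁻¹ * A'), Real.one_le_exp (by positivity), fun ξ ζ hξ hζ => ?_⟩
  have hfoot : ∀ (ξ : RoughRay (HPlus H)) (hξ : ξ.endpoint ≠ ι OnePoint.infty),
      FiniteHausdorff ξ.toFun (HPlus.downRay (e.symm ⟨ξ.endpoint, hξ⟩)) := by
    intro ξ hξ
    refine hι.1 _ ξ ?_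
    rw [← he, Equiv.apply_symm_apply]
  obtain ⟨h1, h2⟩ := hbd ξ ζ _ _ (hfoot ξ hξ) (hfoot ζ hζ)
  change ENNReal.ofReal (_ * dist (e.symm ⟨ξ.endpoint, hξ⟩) (e.symm ⟨ζ.endpoint, hζ⟩)) ≤ _ ∧
    _ ≤ ENNReal.ofReal (_ * dist (e.symm ⟨ξ.endpoint, hξ⟩) (e.symm ⟨ζ.endpoint, hζ⟩))
  generalize e.symm ⟨ξ.endpoint, hξ⟩ = x at *
  generalize e.symm ⟨ζ.endpoint, hζ⟩ = y at *
  have hvis : ∀ t, parabolicVisual (Real.exp κ⁻¹) η ξ ζ t =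
      Real.exp (κ⁻¹ * (t - gromovProd (ξ.toFun t) (ζ.toFun t) (η.toFun t))) := fun t => by
    rw [parabolicVisual, Real.exp_mul]
  have hupper : ∀ r : ℝ, 0 < r → dist x y ≤ r →
      limsup (fun t => ENNReal.ofReal (parabolicVisual (Real.exp κ⁻¹) η ξ ζ t)) atTop ≤
        ENNReal.ofReal (Real.exp (κ⁻¹ * A') * r) := by
    intro r hr hxy
    refine limsup_le_of_le (by isBoundedDefault) ?_
    filter_upwards [h2 r hr hxy] with t ht
    refine ENNReal.ofReal_le_ofReal ?_
    rw [hvis, ← Real.exp_log hr, ← Real.exp_add, Real.exp_le_exp]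
    refine (mul_le_mul_of_nonneg_left ht (inv_pos.2 hκ).le).trans (le_of_eq ?_)
    rw [mul_add, inv_mul_cancel_left₀ hκ.ne', add_comm]
  rcases eq_or_ne x y with rfl | hxy
  · refine ⟨by simp, ?_⟩
    rw [dist_self, mul_zero, ENNReal.ofReal_zero]
    -- For equal end points, the upper bound holds for every positive `r`, so the limit superior
    -- vanishes.
    refine ENNReal.le_of_forall_pos_le_add fun ε hε _ => ?_
    rw [zero_add]
    refine (hupper ((Real.exp (κ⁻¹ * A'))⁻¹ * ε) (by positivity)
      (by rw [dist_self]; positivity)).trans ?_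
    rw [mul_inv_cancel_left₀ (Real.exp_pos _).ne', ENNReal.ofReal_coe_nnreal]
  · have hd := dist_pos.2 hxy
    refine ⟨le_liminf_of_le (by isBoundedDefault) ?_, hupper _ hd le_rfl⟩
    filter_upwards [h1 hxy] with t ht
    refine ENNReal.ofReal_le_ofReal ?_
    rw [hvis, ← Real.exp_neg]
    nth_rewrite 1 [← Real.exp_log hd]
    rw [← Real.exp_add, Real.exp_le_exp]
    refine le_trans (le_of_eq ?_) (mul_le_mul_of_nonneg_left ht (inv_pos.2 hκ).le)
    rw [mul_sub, inv_mul_cancel_left₀ hκ.ne']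
    ring

end IsMetricSimilaritySpace

theorem mainTheorem5 {n : ℕ} {H : Type*} [MetricSpace H] [MetricSpace (HPlus H)]
    [ChartedSpace (EuclideanSpace ℝ (Fin (n + 1))) (HPlus H)]
    [IsManifold (𝓡 (n + 1)) ∞ (HPlus H)]
    [RiemannianBundle (fun p : HPlus H => TangentSpace (𝓡 (n + 1)) p)]
    [IsContMDiffRiemannianBundle (𝓡 (n + 1)) ∞ (EuclideanSpace ℝ (Fin (n + 1)))
      (fun p : HPlus H => TangentSpace (𝓡 (n + 1)) p)]
    [IsRiemannianManifold (𝓡 (n + 1)) (HPlus H)]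
    (T : StackedTiling n H) (hT : IsMetricSimilaritySpace T) :
    IsQuasiIsometry (HPlus.toCone : HPlus H → HypCone H) ∧
      IsGromovHyperbolic (HPlus H) ∧
      ∃ ι : OnePoint H → BoundaryAtInfinity (HPlus H),
        IsEndpointMap ι ∧ Function.Bijective ι ∧
        ∃ e : H ≃ PuncturedBoundary (ι OnePoint.infty),
          (∀ x : H, (e x : BoundaryAtInfinity (HPlus H)) = ι (x : OnePoint H)) ∧
          InParabolicConformalGauge (ι OnePoint.infty)
            (MetricSpace.induced e.symm e.symm.injective inferInstance) := by
  obtain ⟨L, C, hL, hC, hq⟩ := hT.exists_isQuasiEmbedding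
    fun p q _ hε => exists_roughGeodesic (𝓡 (n + 1)) p q hε
  have hX : IsRoughlyGeodesic (HPlus H) := isRoughlyGeodesic_of_riemannian (𝓡 (n + 1))
  have h := ConeComparison.of_quasiEmbedding hL hC hq hX
  have := T.complete
  have : Nonempty H := T.K_interior.to_type
  have hcont : ∀ b : H, Continuous (fun v : ℝ => HypCone.vert b v) := by
    intro b
    rw [hT.product_topology.isInducing.continuous_iff]
    exact continuous_const.prodMk (Real.continuous_exp.subtype_mk _)
  refine ⟨⟨L, C, hL, hC, fun p q => ?_, fun p => ⟨p, ?_⟩⟩, ?_, ?_⟩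
  · have := hq p q
    constructor <;> linarith [this.1, this.2]
  · change dist p p < L
    rw [dist_self]
    linarith
  · exact IsGromovHyperbolic.of_quasiEmbedding hL hC hq (fun p => ⟨p, rfl⟩) hX
      HypCone.isGromovHyperbolic
  obtain ⟨ι, hι, hbij⟩ := h.exists_endpointMap hcont
  have hne : ∀ x : H, ι (x : OnePoint H) ≠ ι OnePoint.infty := fun x hx =>
    OnePoint.coe_ne_infty x (hbij.1 hx)
  let e : H ≃ PuncturedBoundary (ι OnePoint.infty) :=
    Equiv.ofBijective (fun x => ⟨ι x, hne x⟩) (by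
      refine ⟨fun x y hxy => ?_, fun z => ?_⟩
      · exact OnePoint.coe_injective (hbij.1 (congrArg Subtype.val hxy))
      · obtain ⟨p, hp⟩ := hbij.2 z.1
        induction p using OnePoint.rec with
        | infty => exact absurd hp.symm z.2
        | coe x => exact ⟨x, Subtype.ext hp⟩)
  -- The transported metric is itself parabolic visual, so the gauge condition holds with the
  -- identity as distortion function.
  refine ⟨ι, hι, hbij, e, fun _ => rfl, MetricSpace.induced e.symm e.symm.injective inferInstance,
    hT.isParabolicVisualMetric h hι e fun _ => rfl, Function.surjective_id, OrderIso.refl _,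
    fun x y z _ => le_rfl⟩

end
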